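/- Let $N\ge 1$ and let $P:\mathbb R^2\to\mathbb R$ be an admissible homogeneous polynomial of degree $N+1$, that is, a real homogeneous polynomial of degree $N+1$ in two variables whose only critical point is the origin: $\nabla P(\xi)=0$ if and only if $\xi=0$. Let $M$ be the number of nodal lines of $P$, i.e. of lines through the origin on which $P$ vanishes identically. Then $M$ is finite, $M\le N+1$, and the following hold. (i) For every $\eta_0\in\mathbb R^2$ there is $R_0>0$ such that for every $R\ge R_0$ one has $\eta_0\notin\nabla P(\partial B_R(0))$ and the Brouwer degree of $\nabla P$ on the open disk $B_R(0)$ at the value $\eta_0$ is $$\deg(\nabla P,B_R(0),\eta_0)=1-M.$$ (ii) For almost every $\eta_0\in\mathbb R^2$ (with respect to Lebesgue measure) the equation $\nabla P(\xi)=\eta_0$ has at least $|1-M|$ distinct stable solutions. (iii) If $N=2$, then for every $\eta_0\ne0$ the equation $\nabla P(\xi)=\eta_0$ has at least $|1-M|$ distinct stable solutions. Here, for a continuous map $Z:\mathbb R^n\to\mathbb R^n$, a solution $x_0$ of $Z(x)=y$ is called stable if for every $\delta>0$ there is $\varepsilon>0$ such that every continuous $W:\mathbb R^n\to\mathbb R^n$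 with $\sup_{\mathbb R^n}|W-Z|\le\varepsilon$ has a point $x$ with $W(x)=y$ and $|x-x_0|<\delta$. -/

import Mathlib

open MeasureTheory Metric
open scoped ContDiff

noncomputable section

/-- `g` is an admissible smooth approximation of `f` on `closure U` for computing the degree at `y`:
`g` is smooth, `sup_{closure U} |g - f| < dist (y, f (∂U))`, and `y` is a regular value of `g` on
`U`. -/
structure IsRegularApprox {n : ℕ}
    (f : EuclideanSpace ℝ (Fin n) → EuclideanSpace ℝ (Fin n))
    (U : Set (EuclideanSpace ℝ (Fin n))) (y : EuclideanSpace ℝ (Fin n))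
    (g : EuclideanSpace ℝ (Fin n) → EuclideanSpace ℝ (Fin n)) : Prop where
  smooth : ContDiff ℝ ∞ g
  close : ∀ x ∈ closure U, ∀ z ∈ frontier U, ‖g x - f x‖ < ‖f z - y‖
  regular : ∀ x ∈ U, g x = y → (fderiv ℝ g x).det ≠ 0

/-- The signed number of preimages of `y` under `g` in `U`, i.e. the sum of the signs of the
Jacobian determinants of `g` at the solutions of `g x = y` in `U`. -/
def signedCount {n : ℕ}
    (g : EuclideanSpace ℝ (Fin n) → EuclideanSpace ℝ (Fin n))
    (U : Set (EuclideanSpace ℝ (Fin n))) (y : EuclideanSpace ℝ (Fin n)) : ℤ :=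
  ∑ᶠ x ∈ {x | x ∈ U ∧ g x = y}, ((SignType.sign (fderiv ℝ g x).det : SignType) : ℤ)

/-- The Brouwer degree `deg (f, U, y)` is defined and equal to `d`: `U` is bounded and open, `f` is
continuous on `closure U`, `y ∉ f (∂U)`, and `d` is the common value of the signed number of
preimages of `y` in `U` over all smooth approximations `g` of `f` having `y` as a regular value and
satisfying `sup_{closure U} |g - f| < dist (y, f (∂U))` (of which there is at least one). -/
structure HasBrouwerDegree {n : ℕ}
    (f : EuclideanSpace ℝ (Fin n) → EuclideanSpace ℝ (Fin n))
    (U : Set (EuclideanSpace ℝ (Fin n))) (y : EuclideanSpace ℝ (Fin n)) (d : ℤ) : Prop where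
  isOpen : IsOpen U
  isBounded : Bornology.IsBounded U
  continuousOn : ContinuousOn f (closure U)
  notMem : y ∉ f '' frontier U
  exists_approx : ∃ g, IsRegularApprox f U y g
  eq_signedCount : ∀ g, IsRegularApprox f U y g → signedCount g U y = d

/-- The degree is unique when it is defined. -/
theorem HasBrouwerDegree.unique {n : ℕ}
    {f : EuclideanSpace ℝ (Fin n) → EuclideanSpace ℝ (Fin n)}
    {U : Set (EuclideanSpace ℝ (Fin n))} {y : EuclideanSpace ℝ (Fin n)} {d e : ℤ}
    (hd : HasBrouwerDegree f U y d) (he : HasBrouwerDegree f U y e) : d = e := by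
  obtain ⟨g, hg⟩ := hd.exists_approx
  rw [← hd.eq_signedCount g hg, ← he.eq_signedCount g hg]

/-- `x₀` is a stable solution of `Z x = y`: it is a solution, and every continuous map `W` that is
uniformly `ε`-close to `Z` on the whole space has a solution of `W x = y` which is as close to `x₀`
as we like provided that `ε` is small enough. -/
def IsStableSolution {n : ℕ}
    (Z : EuclideanSpace ℝ (Fin n) → EuclideanSpace ℝ (Fin n))
    (y x₀ : EuclideanSpace ℝ (Fin n)) : Prop :=
  Z x₀ = y ∧
    ∀ δ > 0, ∃ ε > 0, ∀ W : EuclideanSpace ℝ (Fin n) → EuclideanSpace ℝ (Fin n),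
      Continuous W → (∀ x, ‖W x - Z x‖ ≤ ε) → ∃ x, W x = y ∧ ‖x - x₀‖ < δ

/-- The polynomial function on the Euclidean plane attached to a polynomial in two variables. -/
def polyFun (P : MvPolynomial (Fin 2) ℝ) : EuclideanSpace ℝ (Fin 2) → ℝ :=
  fun ξ => MvPolynomial.eval (fun i => ξ i) P

/-- The gradient map `∇P : ℝ² → ℝ²`. -/
def gradMap (P : MvPolynomial (Fin 2) ℝ) : EuclideanSpace ℝ (Fin 2) → EuclideanSpace ℝ (Fin 2) :=
  gradient (polyFun P)

/-- `P` is homogeneous of degree `N + 1` and the origin is its only critical point. -/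
structure IsAdmissiblePoly (N : ℕ) (P : MvPolynomial (Fin 2) ℝ) : Prop where
  homogeneous : P.IsHomogeneous (N + 1)
  critical_iff : ∀ ξ : EuclideanSpace ℝ (Fin 2), gradMap P ξ = 0 ↔ ξ = 0

/-- The nodal lines of `P`: the lines through the origin on which `P` vanishes. -/
def nodalLines (P : MvPolynomial (Fin 2) ℝ) : Set (Submodule ℝ (EuclideanSpace ℝ (Fin 2))) :=
  {L | Module.finrank ℝ L = 1 ∧ ∀ ξ ∈ L, polyFun P ξ = 0}

end

/-!
Integrating the pull-back under `g` of a bump form concentrated near `0` counts the zeros of `g`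
with the signs of their Jacobians. The integral is invariant under homotopies without zeros on the
boundary because the Jacobian determinant is a null Lagrangian: if `F` has compact support then,
for small `t`, `x ↦ x + t • F x` is a bijection, so that `∫ det (1 + t • DF)` over the support of
`F` does not depend on `t`, and the leading coefficient `∫ det DF` of this polynomial in `t`
vanishes.

For the homogeneous map `∇P` the integral, in polar coordinates, is the total rotation of `∇P`
along the unit circle. In the rotating frame `∇P` has the coordinates `((N + 1) p, p')`, where `p`
is the restriction of `P` to the circle. The frame turns by `π` along a half-circle, while relative
to the frame `∇P` crosses the second axis clockwise at each zero of `p` and so turns by `-π M`. The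
degree is therefore `1 - M`.

A solution at which `D∇P` is invertible has local degree `±1` and is stable, so there are at least
`|1 - M|` stable solutions over every regular value, hence over almost every value by Sard's
theorem. If `N = 2` and `D∇P` degenerates at some `w ≠ 0`, then `P` is a sum of two cubes in
suitable coordinates, hence `M = 1` and there is nothing to prove; otherwise every `η₀ ≠ 0` is a
regular value.
-/

open Filter Topology Set
open scoped Manifold

section NullLagrangian

variable {E : Type*} [NormedAddCommGroup E] [NormedSpace ℝ E]

theorem eventually_bijective_add_smul [CompleteSpace E] {F : E → E} {K : NNReal}
    (hF : LipschitzWith K F) : ∀ᶠ t in 𝓝 (0 : ℝ), Function.Bijective fun x => x + t • F x := by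
  have hsmall : ∀ᶠ t in 𝓝 (0 : ℝ), ‖t‖₊ * K < 1 := by
    refine ContinuousAt.eventually_lt (by fun_prop) continuousAt_const ?_
    simp
  filter_upwards [hsmall] with t ht
  have happrox : ApproximatesLinearOn (fun x => x + t • F x)
      ((ContinuousLinearEquiv.refl ℝ E : E ≃L[ℝ] E) : E →L[ℝ] E) univ (‖t‖₊ * K) := by
    intro x _ y _
    calc ‖x + t • F x - (y + t • F y) - (x - y)‖ = ‖t‖ * ‖F x - F y‖ := by
          rw [← norm_smul, smul_sub]; congr 1; abel
      _ ≤ ‖t‖ * (K * ‖x - y‖) := by gcongr; exact hF.norm_sub_le x y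
      _ = _ := by rw [NNReal.coe_mul, coe_nnnorm, mul_assoc]
  refine (happrox.toHomeomorph _ ?_).bijective
  rcases subsingleton_or_nontrivial E with hE | hE
  · exact Or.inl hE
  · refine Or.inr (ht.trans_eq ?_)
    have : ((ContinuousLinearEquiv.refl ℝ E).symm : E →L[ℝ] E) = ContinuousLinearMap.id ℝ E := rfl
    rw [this, ContinuousLinearMap.nnnorm_id, inv_one]

theorem eventually_forall_det_one_add_smul_pos {X : Type*} [TopologicalSpace X] {K : Set X}
    (hK : IsCompact K) {A : X → E →L[ℝ] E} (hA : Continuous A) :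
    ∀ᶠ t in 𝓝 (0 : ℝ), ∀ x ∈ K, 0 < (1 + t • A x).det := by
  refine hK.eventually_forall_of_forall_eventually fun x _ => ?_
  have hc : Continuous fun z : ℝ × X => (1 + z.1 • A z.2).det :=
    ContinuousLinearMap.continuous_det.comp (by fun_prop)
  refine hc.continuousAt.eventually_const_lt ?_
  simp [ContinuousLinearMap.det]

/-- `det f` is the leading coefficient of the polynomial `det (1 + t • f)` in `t`, which Lagrange
interpolation recovers from the values at the nodes `v i`. -/
theorem det_eq_sum_det_one_add_smul_div {K V ι : Type*} [Field K] [AddCommGroup V] [Module K V]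
    [FiniteDimensional K V] [DecidableEq ι] (f : V →ₗ[K] V) {s : Finset ι} {v : ι → K}
    (hv : InjOn v s) (hs : s.card = Module.finrank K V + 1) :
    LinearMap.det f =
      ∑ i ∈ s, LinearMap.det (1 + v i • f) / ∏ j ∈ s.erase i, (v i - v j) := by
  open Polynomial in
  set b := Module.finBasis K V
  set A := LinearMap.toMatrix b b f
  set Q : K[X] := Matrix.det ((X : K[X]) • A.map C + (1 : Matrix _ _ K).map C) with hQ
  have hdeg : Q.degree < s.card := by
    rw [hs]
    refine (degree_le_of_natDegree_le (natDegree_det_X_add_C_le A 1)).trans_lt ?_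
    exact_mod_cast (Fintype.card_fin _).trans_lt (Nat.lt_succ_self _)
  have heval (t : K) : Q.eval t = LinearMap.det (1 + t • f) := by
    rw [← LinearMap.det_toMatrix b, hQ, ← coe_evalRingHom, RingHom.map_det]
    congr 1
    ext i j
    by_cases hij : i = j <;> simp [A, LinearMap.toMatrix_one, hij] <;> ring
  have hcoeff : Q.coeff (s.card - 1) = LinearMap.det f := by
    have := coeff_det_X_add_C_card A 1
    rw [Fintype.card_fin] at this
    rw [hs, Nat.add_sub_cancel, this, LinearMap.det_toMatrix]
  rw [← hcoeff, Lagrange.coeff_eq_sum hv hdeg]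
  simp only [heval]

theorem continuous_det_fderiv {g : E → E} (hg : ContDiff ℝ 1 g) :
    Continuous fun x => (fderiv ℝ g x).det :=
  ContinuousLinearMap.continuous_det.comp (hg.continuous_fderiv one_ne_zero)

variable [FiniteDimensional ℝ E]

theorem exists_contDiff_one_nhdsSet {C U : Set E} (hC : IsCompact C) (hU : IsOpen U)
    (hb : Bornology.IsBounded U) (hCU : C ⊆ U) :
    ∃ χ : E → ℝ, ContDiff ℝ 1 χ ∧ HasCompactSupport χ ∧ tsupport χ ⊆ U ∧
      (∀ᶠ x in 𝓝ˢ C, χ x = 1) ∧ ∀ x, χ x ∈ Icc 0 1 := by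
  obtain ⟨χ, hχ0, hχ1, hχ⟩ := exists_contMDiffMap_zero_one_nhds_of_isClosed 𝓘(ℝ, E) (n := 1)
    hU.isClosed_compl hC.isClosed (disjoint_left.mpr fun x hx hxC => hx (hCU hxC))
  have hts : tsupport χ ⊆ U := by
    intro x hx
    by_contra hxU
    exact notMem_tsupport_iff_eventuallyEq.mpr (eventually_nhdsSet_iff_forall.mp hχ0 x hxU) hx
  exact ⟨χ, contMDiff_iff_contDiff.mp χ.contMDiff,
    hb.isCompact_closure.of_isClosed_subset (isClosed_tsupport _) (hts.trans subset_closure),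
    hts, hχ1, hχ⟩

theorem continuousLinearMap_det_zero [Nontrivial E] : (0 : E →L[ℝ] E).det = 0 :=
  LinearMap.det_zero.trans (zero_pow Module.finrank_pos.ne')

variable [MeasurableSpace E] [BorelSpace E] (μ : Measure E) [μ.IsAddHaarMeasure]

/-- For small `t` the map `x ↦ x + t • F x` permutes the support of `F`. -/
theorem eventually_setIntegral_det_one_add_smul_fderiv {F : E → E} (hF : ContDiff ℝ 1 F)
    (hs : HasCompactSupport F) :
    ∀ᶠ t in 𝓝 (0 : ℝ),
      ∫ x in tsupport F, (1 + t • fderiv ℝ F x).det ∂μ = μ.real (tsupport F) := by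
  obtain ⟨c, hc⟩ := hF.lipschitzWith_of_hasCompactSupport hs one_ne_zero
  filter_upwards [eventually_bijective_add_smul hc, eventually_forall_det_one_add_smul_pos
    hs.isCompact (hF.continuous_fderiv one_ne_zero)] with t hbij hpos
  have himage : (fun x => x + t • F x) '' tsupport F = tsupport F := by
    have : EqOn (fun x => x + t • F x) id (tsupport F)ᶜ := fun x hx => by
      simp [image_eq_zero_of_notMem_tsupport hx]
    rw [← compl_inj_iff, ← image_compl_eq hbij, this.image_eq, image_id]
  have hderiv (x : E) : HasFDerivAt (fun x => x + t • F x) (1 + t • fderiv ℝ F x) x :=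
    (hasFDerivAt_id x).add ((hF.differentiable one_ne_zero x).hasFDerivAt.const_smul t)
  have hcov := integral_image_eq_integral_abs_det_fderiv_smul μ
    (isClosed_tsupport F).measurableSet (fun x _ => (hderiv x).hasFDerivWithinAt)
    hbij.injective.injOn (fun _ => (1 : ℝ))
  rw [himage] at hcov
  rw [← mul_one (μ.real _), ← smul_eq_mul, ← setIntegral_const, hcov]
  refine setIntegral_congr_fun (isClosed_tsupport F).measurableSet fun x hx => ?_
  simp [abs_of_pos (hpos x hx)]

variable [Nontrivial E]

theorem integral_det_fderiv_eq_zero {F : E → E} (hF : ContDiff ℝ 1 F)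
    (hs : HasCompactSupport F) : ∫ x, (fderiv ℝ F x).det ∂μ = 0 := by
  classical
  set n := Module.finrank ℝ E
  have hn : 0 < n := Module.finrank_pos
  have hdet0 (x : E) (hx : x ∉ tsupport F) : (fderiv ℝ F x).det = 0 := by
    rw [image_eq_zero_of_notMem_tsupport fun h => hx (tsupport_fderiv_subset ℝ h)]
    exact continuousLinearMap_det_zero
  obtain ⟨s, hsK, hcard⟩ := (infinite_of_mem_nhds (0 : ℝ)
    (eventually_setIntegral_det_one_add_smul_fderiv μ hF hs)).exists_subset_card_eq (n + 1)
  have hconst : ∑ t ∈ s, 1 / ∏ r ∈ s.erase t, (t - r) = (0 : ℝ) := by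
    have hdeg : (1 : Polynomial ℝ).degree < s.card := by
      rw [Polynomial.degree_one, hcard]
      exact_mod_cast n.succ_pos
    have := Lagrange.coeff_eq_sum (v := id) (injOn_id _) hdeg
    simpa [hcard, Polynomial.coeff_one, hn.ne'] using this.symm
  have hcont (t : ℝ) : Continuous fun x => (1 + t • fderiv ℝ F x).det := by
    have := hF.continuous_fderiv one_ne_zero
    exact ContinuousLinearMap.continuous_det.comp (by fun_prop)
  calc ∫ x, (fderiv ℝ F x).det ∂μ
      = ∫ x in tsupport F, (fderiv ℝ F x).det ∂μ :=
        (setIntegral_eq_integral_of_forall_compl_eq_zero hdet0).symm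
    _ = ∫ x in tsupport F, ∑ t ∈ s,
          (1 + t • fderiv ℝ F x).det / ∏ r ∈ s.erase t, (t - r) ∂μ := by
        congr with x
        exact det_eq_sum_det_one_add_smul_div _ (injOn_id _) hcard
    _ = ∑ t ∈ s, μ.real (tsupport F) / ∏ r ∈ s.erase t, (t - r) := by
        rw [integral_finsetSum _ fun t _ => ((hcont t).continuousOn.integrableOn_compact
          hs.isCompact).div_const _]
        refine Finset.sum_congr rfl fun t ht => ?_
        rw [integral_div, hsK ht]
    _ = 0 := by
        simp_rw [div_eq_mul_one_div (μ.real (tsupport F)), ← Finset.mul_sum, hconst, mul_zero]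

theorem integral_det_fderiv_add_sub_eq_zero {F w : E → E} (hF : ContDiff ℝ 1 F)
    (hw : ContDiff ℝ 1 w) (hs : HasCompactSupport w) :
    ∫ x, ((fderiv ℝ (F + w) x).det - (fderiv ℝ F x).det) ∂μ = 0 := by
  obtain ⟨r, hr⟩ := hs.isBounded.subset_ball 0
  obtain ⟨χ, hχ, hχs, -, hχ1, -⟩ :=
    exists_contDiff_one_nhdsSet hs.isCompact isOpen_ball isBounded_ball hr
  set G : E → E := χ • F
  have hG : ContDiff ℝ 1 G := hχ.smul hF
  have hGs : HasCompactSupport G := hχs.smul_right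
  have hGw : ContDiff ℝ 1 (G + w) := hG.add hw
  have hGws : HasCompactSupport (G + w) := hGs.add hs
  have hdiff (x : E) : (fderiv ℝ (F + w) x).det - (fderiv ℝ F x).det =
      (fderiv ℝ (G + w) x).det - (fderiv ℝ G x).det := by
    by_cases hx : x ∈ tsupport w
    · have hloc : G =ᶠ[𝓝 x] F := by
        filter_upwards [eventually_nhdsSet_iff_forall.mp hχ1 x hx] with z hz
        simp [G, hz]
      rw [hloc.fderiv_eq, (hloc.add (.refl _ w)).fderiv_eq]
    · have hloc : w =ᶠ[𝓝 x] 0 := notMem_tsupport_iff_eventuallyEq.mp hx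
      have hadd (H : E → E) : H + w =ᶠ[𝓝 x] H := by
        simpa using (Filter.EventuallyEq.refl _ H).add hloc
      rw [(hadd _).fderiv_eq, (hadd _).fderiv_eq, sub_self, sub_self]
  have hint {H : E → E} (hH : ContDiff ℝ 1 H) (hHs : HasCompactSupport H) :
      Integrable (fun x => (fderiv ℝ H x).det) μ :=
    (continuous_det_fderiv hH).integrable_of_hasCompactSupport
      ((hHs.fderiv ℝ).comp_left continuousLinearMap_det_zero)
  simp_rw [hdiff]
  rw [integral_sub (hint hGw hGws) (hint hG hGs), integral_det_fderiv_eq_zero μ hGw hGws,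
    integral_det_fderiv_eq_zero μ hG hGs, sub_self]

end NullLagrangian

section Pullback

variable {E : Type*} [NormedAddCommGroup E] [NormedSpace ℝ E] [FiniteDimensional ℝ E]

/-- Convolve `φ` with the length measure on the half-line spanned by `e`. -/
theorem exists_contDiff_fderiv_apply_eq {φ : E → ℝ} (hφ : ContDiff ℝ 1 φ)
    (hs : HasCompactSupport φ) {e : E} (he : e ≠ 0) :
    ∃ ψ : E → ℝ, ContDiff ℝ 1 ψ ∧ ∀ v, fderiv ℝ ψ v e = φ v := by
  borelize E
  have hemb : IsClosedEmbedding fun s : ℝ => s • e := isClosedEmbedding_smul_left he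
  set ν : Measure E := (volume.restrict (Ioi 0)).map fun s : ℝ => s • e
  have hν : IsFiniteMeasureOnCompacts ν := ⟨fun K hK => by
    rw [Measure.map_apply hemb.measurable hK.measurableSet]
    exact (Measure.restrict_apply_le _ _).trans_lt
      (hemb.isCompact_preimage hK).measure_lt_top⟩
  set ψ : E → ℝ := convolution (fun _ => (1 : ℝ)) φ (ContinuousLinearMap.lsmul ℝ ℝ) ν
  have hψ : ContDiff ℝ 1 ψ :=
    hs.contDiff_convolution_right (n := 1) _ (locallyIntegrable_const (1 : ℝ)) hφ
  refine ⟨ψ, hψ, fun v => ?_⟩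
  set f : ℝ → ℝ := fun s => φ (v + s • e) with hf
  have hfc : Continuous f := hφ.continuous.comp (by fun_prop)
  have hfint : Integrable f := hfc.integrable_of_hasCompactSupport
    (hs.comp_isClosedEmbedding ((Homeomorph.addLeft v).isClosedEmbedding.comp hemb))
  have hline (τ : ℝ) : ψ (v + τ • e) = ∫ s in Iic τ, f s := by
    have hsub := (volume.measurePreserving_sub_left τ).setIntegral_preimage_emb
      (MeasurableEquiv.subLeft τ).measurableEmbedding f (Iio τ)
    rw [preimage_const_sub_Iio, sub_self] at hsub
    rw [integral_Iic_eq_integral_Iio, ← hsub]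
    simp only [ψ, convolution, ContinuousLinearMap.lsmul_apply, smul_eq_mul, one_mul]
    rw [hemb.measurableEmbedding.integral_map]
    simp only [hf, sub_smul, add_sub_assoc]
  have hderiv : HasDerivAt (fun τ : ℝ => ψ (v + τ • e)) (f 0) 0 := by
    have hFTC := (hfc.integral_hasStrictDerivAt 0 0).hasDerivAt.const_add (ψ v)
    refine hFTC.congr_of_eventuallyEq (.of_forall fun τ => ?_)
    have h0 := hline 0
    rw [zero_smul, add_zero] at h0
    simp only [hline, h0, ← intervalIntegral.integral_Iic_sub_Iic hfint.integrableOn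
      hfint.integrableOn, add_sub_cancel]
  have hfd : HasLineDerivAt ℝ ψ (f 0) v e := hderiv
  rw [← (hψ.differentiable one_ne_zero v).lineDeriv_eq_fderiv, hfd.lineDeriv]
  simp [hf]

theorem exists_contDiff_det_fderiv_eq [Nontrivial E] {φ : E → ℝ} (hφ : ContDiff ℝ 1 φ)
    (hs : HasCompactSupport φ) :
    ∃ Φ : E → E, ContDiff ℝ 1 Φ ∧ ∀ v, (fderiv ℝ Φ v).det = φ v := by
  obtain ⟨e, he⟩ := exists_ne (0 : E)
  obtain ⟨ℓ, hℓ⟩ := SeparatingDual.exists_eq_one (R := ℝ) he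
  obtain ⟨ψ, hψ, hψe⟩ := exists_contDiff_fderiv_apply_eq hφ hs he
  refine ⟨fun v => v + (ψ v - ℓ v) • e, by fun_prop, fun v => ?_⟩
  have hderiv : HasFDerivAt (fun v => v + (ψ v - ℓ v) • e)
      (ContinuousLinearMap.id ℝ E + (fderiv ℝ ψ v - ℓ).smulRight e) v :=
    (hasFDerivAt_id v).add
      (((hψ.differentiable one_ne_zero v).hasFDerivAt.sub ℓ.hasFDerivAt).smul_const e)
  have htransvection : ((ContinuousLinearMap.id ℝ E + (fderiv ℝ ψ v - ℓ).smulRight e :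
      E →L[ℝ] E) : E →ₗ[ℝ] E) = LinearMap.transvection (fderiv ℝ ψ v - ℓ : E →L[ℝ] ℝ) e := by
    ext x
    simp [LinearMap.transvection.apply]
  rw [hderiv.fderiv, ContinuousLinearMap.det, htransvection, LinearMap.transvection.det]
  simp [hψe, hℓ]

/-- Glue `g₁` on the compact set where the homotopy meets `S` to `g₀` off `U`. -/
theorem exists_hasCompactSupport_add_eq_of_homotopy {g₀ g₁ : E → E} (hg₀ : ContDiff ℝ 1 g₀)
    (hg₁ : ContDiff ℝ 1 g₁) {U S : Set E} (hU : IsOpen U) (hb : Bornology.IsBounded U)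
    (hS : IsClosed S)
    (h : ∀ x ∈ frontier U, ∀ t ∈ Icc (0 : ℝ) 1, g₀ x + t • (g₁ x - g₀ x) ∉ S) :
    ∃ w : E → E, ContDiff ℝ 1 w ∧ HasCompactSupport w ∧ tsupport w ⊆ U ∧
      ∀ x ∈ U, g₀ + w =ᶠ[𝓝 x] g₁ ∨ ((g₀ + w) x ∉ S ∧ g₁ x ∉ S) := by
  have hcont : Continuous fun z : ℝ × E => g₀ z.2 + z.1 • (g₁ z.2 - g₀ z.2) := by
    have := hg₀.continuous
    have := hg₁.continuous
    fun_prop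
  set C := Prod.snd '' ((Icc (0 : ℝ) 1 ×ˢ closure U) ∩
    (fun z => g₀ z.2 + z.1 • (g₁ z.2 - g₀ z.2)) ⁻¹' S)
  have hC : IsCompact C := ((isCompact_Icc.prod hb.isCompact_closure).inter_right
    (hS.preimage hcont)).image continuous_snd
  have hCU : C ⊆ U := by
    rintro _ ⟨⟨t, x⟩, ⟨⟨ht, hx⟩, hmem⟩, rfl⟩
    by_contra hxU
    exact h x ⟨hx, fun hi => hxU (interior_subset hi)⟩ t ht hmem
  obtain ⟨χ, hχ, hχs, hχU, hχC, hχ01⟩ := exists_contDiff_one_nhdsSet hC hU hb hCU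
  refine ⟨χ • (g₁ - g₀), hχ.smul (hg₁.sub hg₀), hχs.smul_right,
    (tsupport_smul_subset_left χ _).trans hχU, fun x hx => ?_⟩
  by_cases hxC : x ∈ C
  · left
    filter_upwards [eventually_nhdsSet_iff_forall.mp hχC x hxC] with z hz
    simp [hz]
  · have havoid {t : ℝ} (ht : t ∈ Icc (0 : ℝ) 1) : g₀ x + t • (g₁ x - g₀ x) ∉ S :=
      fun hmem => hxC ⟨(t, x), ⟨⟨ht, subset_closure hx⟩, hmem⟩, rfl⟩
    exact Or.inr ⟨havoid (hχ01 x), by simpa using havoid (right_mem_Icc.mpr zero_le_one)⟩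

variable [MeasurableSpace E] [BorelSpace E] (μ : Measure E)

theorem integrableOn_comp_mul_det_fderiv [IsFiniteMeasureOnCompacts μ] {φ : E → ℝ}
    (hφ : Continuous φ) {g : E → E} (hg : ContDiff ℝ 1 g) {U : Set E} (hb : Bornology.IsBounded U) :
    IntegrableOn (fun x => φ (g x) * (fderiv ℝ g x).det) U μ :=
  (((hφ.comp hg.continuous).mul (continuous_det_fderiv hg)).continuousOn
    |>.integrableOn_compact hb.isCompact_closure).mono_set subset_closure

variable [μ.IsAddHaarMeasure] {φ : E → ℝ} (hφ : ContDiff ℝ 1 φ) (hs : HasCompactSupport φ)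

include hφ hs

/-- The form `φ(v) dv` is the pull-back of the volume form by some map `Φ`, so its pull-back by `F`
is the Jacobian of `Φ ∘ F`. -/
theorem integral_comp_mul_det_fderiv_add_sub_eq_zero [Nontrivial E] {F w : E → E}
    (hF : ContDiff ℝ 1 F) (hw : ContDiff ℝ 1 w) (hws : HasCompactSupport w) :
    ∫ x, (φ ((F + w) x) * (fderiv ℝ (F + w) x).det - φ (F x) * (fderiv ℝ F x).det) ∂μ = 0 := by
  obtain ⟨Φ, hΦ, hdet⟩ := exists_contDiff_det_fderiv_eq hφ hs
  have hchain {G : E → E} (hG : ContDiff ℝ 1 G) (x : E) :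
      φ (G x) * (fderiv ℝ G x).det = (fderiv ℝ (Φ ∘ G) x).det := by
    rw [fderiv_comp x (hΦ.differentiable one_ne_zero _) (hG.differentiable one_ne_zero x), ← hdet]
    exact (LinearMap.det_comp _ _).symm
  have hdiffs : HasCompactSupport (Φ ∘ (F + w) - Φ ∘ F) :=
    hws.mono' fun x hx => by
      contrapose! hx
      simp [image_eq_zero_of_notMem_tsupport hx]
  have hFw : ContDiff ℝ 1 (F + w) := hF.add hw
  simp_rw [hchain hF, hchain hFw]
  have hzero := integral_det_fderiv_add_sub_eq_zero μ (w := Φ ∘ (F + w) - Φ ∘ F) (hΦ.comp hF)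
    ((hΦ.comp hFw).sub (hΦ.comp hF)) hdiffs
  rwa [add_sub_cancel] at hzero

theorem setIntegral_comp_mul_det_fderiv_eq_of_homotopy {g₀ g₁ : E → E} (hg₀ : ContDiff ℝ 1 g₀)
    (hg₁ : ContDiff ℝ 1 g₁) {U : Set E} (hU : IsOpen U) (hb : Bornology.IsBounded U)
    (h : ∀ x ∈ frontier U, ∀ t ∈ Icc (0 : ℝ) 1, g₀ x + t • (g₁ x - g₀ x) ∉ tsupport φ) :
    ∫ x in U, φ (g₁ x) * (fderiv ℝ g₁ x).det ∂μ =
      ∫ x in U, φ (g₀ x) * (fderiv ℝ g₀ x).det ∂μ := by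
  rcases subsingleton_or_nontrivial E with hE | hE
  · rw [Subsingleton.elim g₁ g₀]
  obtain ⟨w, hw, hws, hwU, hglue⟩ :=
    exists_hasCompactSupport_add_eq_of_homotopy hg₀ hg₁ hU hb (isClosed_tsupport φ) h
  have hg₀w : ContDiff ℝ 1 (g₀ + w) := hg₀.add hw
  have hinside : ∀ x ∈ U, φ ((g₀ + w) x) * (fderiv ℝ (g₀ + w) x).det =
      φ (g₁ x) * (fderiv ℝ g₁ x).det := by
    intro x hx
    rcases hglue x hx with hloc | ⟨havoid₀, havoid₁⟩
    · rw [hloc.fderiv_eq, hloc.self_of_nhds]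
    · rw [image_eq_zero_of_notMem_tsupport havoid₀, image_eq_zero_of_notMem_tsupport havoid₁,
        zero_mul, zero_mul]
  have houtside : ∀ x ∉ U, φ ((g₀ + w) x) * (fderiv ℝ (g₀ + w) x).det -
      φ (g₀ x) * (fderiv ℝ g₀ x).det = 0 := by
    intro x hx
    have hloc : g₀ + w =ᶠ[𝓝 x] g₀ := by
      filter_upwards [notMem_tsupport_iff_eventuallyEq.mp fun hxw => hx (hwU hxw)] with z hz
      simp [hz]
    rw [hloc.fderiv_eq, hloc.self_of_nhds, sub_self]
  have hzero := integral_comp_mul_det_fderiv_add_sub_eq_zero μ hφ hs hg₀ hw hws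
  rwa [← setIntegral_eq_integral_of_forall_compl_eq_zero houtside,
    integral_sub (integrableOn_comp_mul_det_fderiv μ hφ.continuous hg₀w hb)
      (integrableOn_comp_mul_det_fderiv μ hφ.continuous hg₀ hb),
    sub_eq_zero, setIntegral_congr_fun hU.measurableSet hinside] at hzero

end Pullback

section Degree

variable {n : ℕ}

/-- A smooth radial bump, positive exactly on the ball of radius `ε` about the origin. -/
noncomputable def radialBump (ε : ℝ) (v : EuclideanSpace ℝ (Fin n)) : ℝ :=
  Real.smoothTransition (1 - ‖v‖ ^ 2 / ε ^ 2)

/-- The integral over `U` of the pull-back under `g` of the form `radialBump ε v dv`: for small `ε`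
it is the degree of `g` on `U` at `0`, times the integral of the bump. -/
noncomputable def degreeIntegral (g : EuclideanSpace ℝ (Fin n) → EuclideanSpace ℝ (Fin n))
    (U : Set (EuclideanSpace ℝ (Fin n))) (ε : ℝ) : ℝ :=
  ∫ x in U, radialBump ε (g x) * (fderiv ℝ g x).det

theorem contDiff_radialBump (ε : ℝ) :
    ContDiff ℝ 1 (radialBump ε : EuclideanSpace ℝ (Fin n) → ℝ) :=
  Real.smoothTransition.contDiff.comp
    (contDiff_const.sub ((contDiff_norm_sq ℝ).div_const _))

theorem continuous_radialBump (ε : ℝ) :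
    Continuous (radialBump ε : EuclideanSpace ℝ (Fin n) → ℝ) :=
  (contDiff_radialBump ε).continuous

theorem radialBump_eq_zero {ε : ℝ} (hε : 0 < ε) {v : EuclideanSpace ℝ (Fin n)} (hv : ε ≤ ‖v‖) :
    radialBump ε v = 0 := by
  refine Real.smoothTransition.zero_of_nonpos (sub_nonpos.mpr ?_)
  rw [one_le_div (by positivity)]
  gcongr

theorem tsupport_radialBump_subset {ε : ℝ} (hε : 0 < ε) :
    tsupport (radialBump ε : EuclideanSpace ℝ (Fin n) → ℝ) ⊆ closedBall 0 ε := by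
  refine closure_minimal (fun v hv => ?_) isClosed_closedBall
  rw [mem_closedBall_zero_iff]
  by_contra! h
  exact hv (radialBump_eq_zero hε h.le)

theorem hasCompactSupport_radialBump {ε : ℝ} (hε : 0 < ε) :
    HasCompactSupport (radialBump ε : EuclideanSpace ℝ (Fin n) → ℝ) :=
  (isCompact_closedBall 0 ε).of_isClosed_subset (isClosed_tsupport _)
    (tsupport_radialBump_subset hε)

theorem integral_radialBump_pos {ε : ℝ} (hε : 0 < ε) :
    0 < ∫ v : EuclideanSpace ℝ (Fin n), radialBump ε v :=
  (continuous_radialBump ε).integral_pos_of_hasCompactSupport_nonneg_nonzero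
    (hasCompactSupport_radialBump hε) (fun _ => Real.smoothTransition.nonneg _) (x := 0)
    (by simp [radialBump])

theorem exists_pos_le_norm_of_isCompact {X F : Type*} [TopologicalSpace X] [NormedAddCommGroup F]
    {g : X → F} {K : Set X} (hK : IsCompact K) (hg : ContinuousOn g K) (h0 : ∀ x ∈ K, g x ≠ 0) :
    ∃ m > 0, ∀ x ∈ K, m ≤ ‖g x‖ := by
  rcases K.eq_empty_or_nonempty with rfl | hne
  · exact ⟨1, one_pos, by simp⟩
  · obtain ⟨x, hx, hmin⟩ := hK.exists_isMinOn hne hg.norm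
    exact ⟨‖g x‖, norm_pos_iff.mpr (h0 x hx), fun z hz => hmin hz⟩

theorem norm_sub_norm_sub_le_norm_add_smul_sub {F : Type*} [NormedAddCommGroup F]
    [NormedSpace ℝ F] (a b : F) {t : ℝ} (ht : t ∈ Icc (0 : ℝ) 1) :
    ‖a‖ - ‖b - a‖ ≤ ‖a + t • (b - a)‖ := by
  have hscale : ‖t • (b - a)‖ ≤ ‖b - a‖ := by
    rw [norm_smul, Real.norm_of_nonneg ht.1]
    exact mul_le_of_le_one_left (norm_nonneg _) ht.2
  linarith [norm_sub_le_norm_add a (t • (b - a))]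

variable {f g : EuclideanSpace ℝ (Fin n) → EuclideanSpace ℝ (Fin n)}
  {U V : Set (EuclideanSpace ℝ (Fin n))} {y : EuclideanSpace ℝ (Fin n)}

theorem eventually_degreeIntegral_eq_of_norm_sub_lt (hf : ContDiff ℝ 1 f) (hg : ContDiff ℝ 1 g)
    (hU : IsOpen U) (hb : Bornology.IsBounded U) (h : ∀ x ∈ frontier U, ‖g x - f x‖ < ‖f x‖) :
    ∀ᶠ ε in 𝓝[>] (0 : ℝ), degreeIntegral g U ε = degreeIntegral f U ε := by
  have hfr : IsCompact (frontier U) :=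
    hb.isCompact_closure.of_isClosed_subset isClosed_frontier frontier_subset_closure
  obtain ⟨m, hm, hgap⟩ := exists_pos_le_norm_of_isCompact hfr
    (g := fun x => ‖f x‖ - ‖g x - f x‖)
    (hf.continuous.norm.sub (hg.continuous.sub hf.continuous).norm).continuousOn
    fun x hx => (sub_pos.mpr (h x hx)).ne'
  filter_upwards [Ioo_mem_nhdsGT hm] with ε hε
  refine setIntegral_comp_mul_det_fderiv_eq_of_homotopy volume (contDiff_radialBump ε)
    (hasCompactSupport_radialBump hε.1) hf hg hU hb fun x hx t ht hmem => ?_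
  have hle := mem_closedBall_zero_iff.mp (tsupport_radialBump_subset hε.1 hmem)
  have hgapx := hgap x hx
  rw [Real.norm_of_nonneg (sub_pos.mpr (h x hx)).le] at hgapx
  linarith [norm_sub_norm_sub_le_norm_add_smul_sub (f x) (g x) ht, hε.2]

theorem eventually_degreeIntegral_eq_of_zeros_mem (hg : Continuous g) (hU : IsOpen U)
    (hb : Bornology.IsBounded U) (hV : IsOpen V) (hVU : V ⊆ U)
    (h0 : ∀ x ∈ closure U, g x = 0 → x ∈ V) :
    ∀ᶠ ε in 𝓝[>] (0 : ℝ), degreeIntegral g U ε = degreeIntegral g V ε := by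
  obtain ⟨m, hm, hgm⟩ := exists_pos_le_norm_of_isCompact (hb.isCompact_closure.diff hV)
    hg.continuousOn fun x hx hgx => hx.2 (h0 x hx.1 hgx)
  filter_upwards [Ioc_mem_nhdsGT hm] with ε hε
  refine setIntegral_eq_of_subset_of_forall_sdiff_eq_zero hU.measurableSet hVU fun x hx => ?_
  rw [radialBump_eq_zero hε.1 (hε.2.trans (hgm x ⟨subset_closure hx.1, hx.2⟩)), zero_mul]

theorem exists_isOpen_injOn_of_det_ne_zero (hg : ContDiff ℝ 1 g) {x : EuclideanSpace ℝ (Fin n)}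
    (hx : (fderiv ℝ g x).det ≠ 0) :
    ∃ V, IsOpen V ∧ x ∈ V ∧ InjOn g V ∧ (∀ W ⊆ V, IsOpen W → IsOpen (g '' W)) ∧
      ∀ z ∈ V, SignType.sign (fderiv ℝ g z).det = SignType.sign (fderiv ℝ g x).det := by
  have hs : HasStrictFDerivAt g ((fderiv ℝ g x).toContinuousLinearEquivOfDetNeZero hx :
      EuclideanSpace ℝ (Fin n) →L[ℝ] EuclideanSpace ℝ (Fin n)) x :=
    hg.contDiffAt.hasStrictFDerivAt one_ne_zero
  set e := hs.toOpenPartialHomeomorph g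
  have hcont : ContinuousAt (fun z => SignType.sign (fderiv ℝ g z).det) x :=
    ContinuousAt.comp (f := fun z => (fderiv ℝ g z).det) (continuousAt_sign_of_ne_zero hx)
      (continuous_det_fderiv hg).continuousAt
  obtain ⟨T, hT, hTo, hxT⟩ := _root_.eventually_nhds_iff.mp
    (hcont.eventually_mem ((isOpen_discrete {_}).mem_nhds rfl))
  exact ⟨e.source ∩ T, e.open_source.inter hTo, ⟨hs.mem_toOpenPartialHomeomorph_source, hxT⟩,
    e.injOn.mono inter_subset_left,
    fun W hW hWo => e.isOpen_image_of_subset_source hWo (hW.trans inter_subset_left),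
    fun z hz => hT z hz.2⟩

theorem degreeIntegral_eq_sign_mul_of_injOn (hg : ContDiff ℝ 1 g) (hU : MeasurableSet U)
    (hinj : InjOn g U) {σ : SignType} (hσ : ∀ x ∈ U, SignType.sign (fderiv ℝ g x).det = σ)
    {ε : ℝ} (hε : 0 < ε) (hball : ball 0 ε ⊆ g '' U) :
    degreeIntegral g U ε = ((σ : ℤ) : ℝ) * ∫ v : EuclideanSpace ℝ (Fin n), radialBump ε v := by
  have hcov := integral_image_eq_integral_abs_det_fderiv_smul volume hU
    (fun x _ => (hg.differentiable one_ne_zero x).hasFDerivAt.hasFDerivWithinAt) hinj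
    (radialBump ε)
  have hfull : ∫ v in g '' U, radialBump ε v =
      ∫ v : EuclideanSpace ℝ (Fin n), radialBump ε v := by
    refine setIntegral_eq_integral_of_forall_compl_eq_zero fun v hv => radialBump_eq_zero hε ?_
    by_contra! hlt
    exact hv (hball (mem_ball_zero_iff.mpr hlt))
  rw [← hfull, hcov, ← integral_const_mul]
  refine setIntegral_congr_fun hU fun x hx => ?_
  have habs := sign_mul_abs (fderiv ℝ g x).det
  rw [hσ x hx] at habs
  simp only [smul_eq_mul]
  rw [← mul_assoc, SignType.intCast_cast, habs, mul_comm]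

theorem eventually_degreeIntegral_ball_eq_sign_mul (hg : ContDiff ℝ 1 g)
    {x : EuclideanSpace ℝ (Fin n)} (h0 : g x = 0) (hx : (fderiv ℝ g x).det ≠ 0) :
    ∀ᶠ r in 𝓝[>] (0 : ℝ), ∀ᶠ ε in 𝓝[>] (0 : ℝ), degreeIntegral g (ball x r) ε =
      ((SignType.sign (fderiv ℝ g x).det : ℤ) : ℝ) *
        ∫ v : EuclideanSpace ℝ (Fin n), radialBump ε v := by
  obtain ⟨V, hV, hxV, hinj, hopen, hsign⟩ := exists_isOpen_injOn_of_det_ne_zero hg hx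
  obtain ⟨r₀, hr₀, hball⟩ := isOpen_iff.mp hV x hxV
  filter_upwards [Ioc_mem_nhdsGT hr₀] with r hr
  have hsub : ball x r ⊆ V := (ball_subset_ball hr.2).trans hball
  obtain ⟨ρ, hρ, himage⟩ := isOpen_iff.mp (hopen _ hsub isOpen_ball) 0
    ⟨x, mem_ball_self hr.1, h0⟩
  filter_upwards [Ioc_mem_nhdsGT hρ] with ε hε
  exact degreeIntegral_eq_sign_mul_of_injOn hg measurableSet_ball (hinj.mono hsub)
    (fun z hz => hsign z (hsub hz)) hε.1 ((ball_subset_ball hε.2).trans himage)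

theorem finite_setOf_eq_of_det_ne_zero (hg : ContDiff ℝ 1 g) (hb : Bornology.IsBounded U)
    (hy : y ∉ g '' frontier U) (hreg : ∀ x ∈ U, g x = y → (fderiv ℝ g x).det ≠ 0) :
    {x | x ∈ U ∧ g x = y}.Finite := by
  have hclosure : {x | x ∈ U ∧ g x = y} = closure U ∩ g ⁻¹' {y} := by
    refine Subset.antisymm (fun x hx => ⟨subset_closure hx.1, hx.2⟩) fun x hx => ⟨?_, hx.2⟩
    by_contra hxU
    exact hy ⟨x, ⟨hx.1, fun hi => hxU (interior_subset hi)⟩, hx.2⟩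
  have hcompact : IsCompact {x | x ∈ U ∧ g x = y} := hclosure ▸
    hb.isCompact_closure.inter_right (isClosed_singleton.preimage hg.continuous)
  refine hcompact.finite (isDiscrete_iff_forall_mem_exists_isOpen.mpr ?_)
  rintro x ⟨hxU, hx⟩
  obtain ⟨V, hV, hxV, hinj, -⟩ := exists_isOpen_injOn_of_det_ne_zero hg (hreg x hxU hx)
  refine ⟨V, hV, Subset.antisymm (fun z hz => hinj hz.1 hxV (hz.2.2.trans hx.symm)) ?_⟩
  exact singleton_subset_iff.mpr ⟨hxV, hxU, hx⟩

theorem degreeIntegral_biUnion_finset {ι : Type*} (s : Finset ι)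
    {W : ι → Set (EuclideanSpace ℝ (Fin n))} (hg : ContDiff ℝ 1 g)
    (hW : ∀ i ∈ s, MeasurableSet (W i)) (hb : ∀ i ∈ s, Bornology.IsBounded (W i))
    (hdisj : (s : Set ι).PairwiseDisjoint W) {ε : ℝ} :
    degreeIntegral g (⋃ i ∈ s, W i) ε = ∑ i ∈ s, degreeIntegral g (W i) ε :=
  integral_biUnion_finset s hW hdisj fun i hi =>
    integrableOn_comp_mul_det_fderiv volume (continuous_radialBump ε) hg (hb i hi)

theorem eventually_degreeIntegral_eq_signedCount (hg : ContDiff ℝ 1 g) (hU : IsOpen U)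
    (hb : Bornology.IsBounded U) (h0 : 0 ∉ g '' frontier U)
    (hreg : ∀ x ∈ U, g x = 0 → (fderiv ℝ g x).det ≠ 0) :
    ∀ᶠ ε in 𝓝[>] (0 : ℝ), degreeIntegral g U ε =
      signedCount g U 0 * ∫ v : EuclideanSpace ℝ (Fin n), radialBump ε v := by
  have hfin := finite_setOf_eq_of_det_ne_zero hg hb h0 hreg
  set S := {x | x ∈ U ∧ g x = 0}
  obtain ⟨T, hT, hdisj⟩ := hfin.t2_separation
  have hradius : ∀ x ∈ S, ∃ r > 0, ball x r ⊆ U ∩ T x ∧ ∀ᶠ ε in 𝓝[>] (0 : ℝ),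
      degreeIntegral g (ball x r) ε = ((SignType.sign (fderiv ℝ g x).det : ℤ) : ℝ) *
        ∫ v : EuclideanSpace ℝ (Fin n), radialBump ε v := by
    intro x hx
    obtain ⟨r₀, hr₀, hball⟩ := isOpen_iff.mp (hU.inter (hT x).2) x ⟨hx.1, (hT x).1⟩
    obtain ⟨r, hr, hdeg⟩ := ((eventually_mem_set.mpr (Ioc_mem_nhdsGT hr₀)).and
      (eventually_degreeIntegral_ball_eq_sign_mul hg hx.2 (hreg x hx.1 hx.2))).exists
    exact ⟨r, hr.1, (ball_subset_ball hr.2).trans hball, hdeg⟩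
  choose! r hr hsub hdeg using hradius
  have hexcise : ∀ᶠ ε in 𝓝[>] (0 : ℝ), degreeIntegral g U ε =
      degreeIntegral g (⋃ x ∈ hfin.toFinset, ball x (r x)) ε := by
    refine eventually_degreeIntegral_eq_of_zeros_mem hg.continuous hU hb
      (isOpen_biUnion fun _ _ => isOpen_ball)
      (iUnion₂_subset fun x hx => (hsub x (hfin.mem_toFinset.mp hx)).trans inter_subset_left)
      fun x hx hgx => ?_
    have hxS : x ∈ S := ⟨by_contra fun hxU =>
      h0 ⟨x, ⟨hx, fun hi => hxU (interior_subset hi)⟩, hgx⟩, hgx⟩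
    exact mem_biUnion (hfin.mem_toFinset.mpr hxS) (mem_ball_self (hr x hxS))
  filter_upwards [hexcise, (eventually_all_finite hfin).mpr hdeg] with ε hε hεdeg
  rw [hε, degreeIntegral_biUnion_finset _ hg (fun _ _ => measurableSet_ball)
      (fun _ _ => isBounded_ball) fun x hx z hz hxz =>
        (hdisj (hfin.mem_toFinset.mp hx) (hfin.mem_toFinset.mp hz) hxz).mono
          ((hsub x (hfin.mem_toFinset.mp hx)).trans inter_subset_right)
          ((hsub z (hfin.mem_toFinset.mp hz)).trans inter_subset_right),
    Finset.sum_congr rfl fun x hx => hεdeg x (hfin.mem_toFinset.mp hx), ← Finset.sum_mul,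
    signedCount, finsum_mem_eq_finite_toFinset_sum _ hfin]
  push_cast
  rfl

theorem signedCount_sub_const (g : EuclideanSpace ℝ (Fin n) → EuclideanSpace ℝ (Fin n))
    (U : Set (EuclideanSpace ℝ (Fin n))) (y : EuclideanSpace ℝ (Fin n)) :
    signedCount (fun x => g x - y) U 0 = signedCount g U y := by
  simp only [signedCount, sub_eq_zero, fderiv_sub_const]

theorem ae_forall_eq_imp_det_fderiv_ne_zero (hg : Differentiable ℝ g) :
    ∀ᵐ y : EuclideanSpace ℝ (Fin n), ∀ x, g x = y → (fderiv ℝ g x).det ≠ 0 := by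
  have hnull := addHaar_image_eq_zero_of_det_fderivWithin_eq_zero volume
    (s := {x | (fderiv ℝ g x).det = 0}) (fun x _ => (hg x).hasFDerivAt.hasFDerivWithinAt)
    fun x hx => hx
  filter_upwards [measure_eq_zero_iff_ae_notMem.mp hnull] with y hy x hx hdet
  exact hy ⟨x, hdet, hx⟩

theorem exists_isRegularApprox (hf : ContDiff ℝ ∞ f) (hb : Bornology.IsBounded U)
    (hy : y ∉ f '' frontier U) : ∃ g, IsRegularApprox f U y g := by
  obtain ⟨m, hm, hgap⟩ := exists_pos_le_norm_of_isCompact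
    (hb.isCompact_closure.of_isClosed_subset isClosed_frontier frontier_subset_closure)
    (hf.continuous.sub continuous_const).continuousOn
    fun x hx h => hy ⟨x, hx, sub_eq_zero.mp h⟩
  obtain ⟨z, hreg, hz⟩ := (Measure.dense_of_ae (ae_forall_eq_imp_det_fderiv_ne_zero
    (hf.differentiable (by simp)))).exists_dist_lt y hm
  refine ⟨fun x => f x - (z - y), hf.sub contDiff_const, fun x _ w hw => ?_, fun x _ hx => ?_⟩
  · rw [sub_sub_cancel_left, norm_neg, ← dist_eq_norm, dist_comm]
    exact hz.trans_le (hgap w hw)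
  · rw [fderiv_sub_const]
    exact hreg x (by rw [← sub_eq_zero, ← sub_eq_zero.mpr hx]; abel)

theorem exists_eq_zero_of_frequently_degreeIntegral_ne_zero (hf : ContDiff ℝ 1 f) (hU : IsOpen U)
    (hb : Bornology.IsBounded U) (hdeg : ∃ᶠ ε in 𝓝[>] (0 : ℝ), degreeIntegral f U ε ≠ 0)
    (hg : Continuous g) (h : ∀ x ∈ frontier U, ‖g x - f x‖ < ‖f x‖) : ∃ x ∈ U, g x = 0 := by
  by_contra! hno
  have hg0 : ∀ x ∈ closure U, g x ≠ 0 := fun x hx hgx => by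
    by_cases hxU : x ∈ U
    · exact hno x hxU hgx
    · simpa [hgx] using h x ⟨hx, fun hi => hxU (interior_subset hi)⟩
  obtain ⟨m, hm, hgm⟩ := exists_pos_le_norm_of_isCompact hb.isCompact_closure hg.continuousOn hg0
  obtain ⟨m', hm', hgap⟩ := exists_pos_le_norm_of_isCompact
    (hb.isCompact_closure.of_isClosed_subset isClosed_frontier frontier_subset_closure)
    (g := fun x => ‖f x‖ - ‖g x - f x‖)
    (hf.continuous.norm.sub (hg.sub hf.continuous).norm).continuousOn
    fun x hx => (sub_pos.mpr (h x hx)).ne'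
  obtain ⟨G, hG, hGg, -⟩ := hg.exists_contDiff_approx 1 (ε := fun _ => min m m')
    continuous_const fun _ => by positivity
  simp only [dist_eq_norm, lt_min_iff] at hGg
  have hG0 : ∀ x ∈ closure U, G x ≠ 0 := fun x hx hGx => by
    have := hgm x hx
    have := (hGg x).1
    rw [hGx, zero_sub, norm_neg] at this
    linarith
  have hGf : ∀ x ∈ frontier U, ‖G x - f x‖ < ‖f x‖ := fun x hx => by
    have hle := hgap x hx
    rw [Real.norm_of_nonneg (sub_pos.mpr (h x hx)).le] at hle
    linarith [norm_sub_le_norm_sub_add_norm_sub (G x) (g x) (f x), (hGg x).2]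
  have hzero := eventually_degreeIntegral_eq_of_zeros_mem hG.continuous hU hb isOpen_empty
    (empty_subset U) fun x hx hGx => hG0 x hx hGx
  obtain ⟨ε, hε, hGε, hGε'⟩ := (hdeg.and_eventually
    (hzero.and (eventually_degreeIntegral_eq_of_norm_sub_lt hf hG hU hb hGf))).exists
  rw [hGε, degreeIntegral, setIntegral_empty] at hGε'
  exact hε hGε'.symm

theorem HasBrouwerDegree.of_frequently_degreeIntegral_eq (hf : ContDiff ℝ ∞ f) (hU : IsOpen U)
    (hb : Bornology.IsBounded U) (hy : y ∉ f '' frontier U) {d : ℤ}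
    (hd : ∃ᶠ ε in 𝓝[>] (0 : ℝ), degreeIntegral (fun x => f x - y) U ε =
      d * ∫ v : EuclideanSpace ℝ (Fin n), radialBump ε v) :
    HasBrouwerDegree f U y d := by
  refine ⟨hU, hb, hf.continuous.continuousOn, hy, exists_isRegularApprox hf hb hy, fun g hg => ?_⟩
  have hf₁ : ContDiff ℝ 1 fun x => f x - y := (hf.sub contDiff_const).of_le (by simp)
  have hg₁ : ContDiff ℝ 1 fun x => g x - y := (hg.smooth.sub contDiff_const).of_le (by simp)
  have hclose : ∀ x ∈ frontier U, ‖(g x - y) - (f x - y)‖ < ‖f x - y‖ := fun x hx => by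
    rw [sub_sub_sub_cancel_right]
    exact hg.close x (frontier_subset_closure hx) x hx
  have hg0 : 0 ∉ (fun x => g x - y) '' frontier U := by
    rintro ⟨x, hx, hgx : g x - y = 0⟩
    have := hclose x hx
    rw [hgx, zero_sub, norm_neg] at this
    exact lt_irrefl _ this
  have hcount := eventually_degreeIntegral_eq_signedCount hg₁ hU hb hg0 fun x hx hgx => by
    rw [fderiv_sub_const]
    exact hg.regular x hx (sub_eq_zero.mp hgx)
  obtain ⟨ε, hdε, hε, hgf, hgε⟩ := (hd.and_eventually (eventually_mem_nhdsWithin.and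
    ((eventually_degreeIntegral_eq_of_norm_sub_lt hf₁ hg₁ hU hb hclose).and hcount))).exists
  rw [hgf, hdε, signedCount_sub_const] at hgε
  exact_mod_cast (mul_right_cancel₀ (integral_radialBump_pos hε).ne' hgε).symm

end Degree

section Stability

variable {n : ℕ} {Z : EuclideanSpace ℝ (Fin n) → EuclideanSpace ℝ (Fin n)}
  {U : Set (EuclideanSpace ℝ (Fin n))} {y : EuclideanSpace ℝ (Fin n)}

theorem isStableSolution_of_det_ne_zero (hZ : ContDiff ℝ 1 Z) {x₀ : EuclideanSpace ℝ (Fin n)}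
    (hx₀ : Z x₀ = y) (hdet : (fderiv ℝ Z x₀).det ≠ 0) : IsStableSolution Z y x₀ := by
  refine ⟨hx₀, fun δ hδ => ?_⟩
  have hZy : ContDiff ℝ 1 fun x => Z x - y := hZ.sub contDiff_const
  have hdet' : (fderiv ℝ (fun x => Z x - y) x₀).det ≠ 0 := by rwa [fderiv_sub_const]
  obtain ⟨V, hV, hxV, hinj, -⟩ := exists_isOpen_injOn_of_det_ne_zero hZ hdet
  obtain ⟨r₀, hr₀, hball⟩ := isOpen_iff.mp hV x₀ hxV
  obtain ⟨r, hr, hdeg⟩ := ((eventually_mem_set.mpr (Ioo_mem_nhdsGT (lt_min hδ hr₀))).and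
    (eventually_degreeIntegral_ball_eq_sign_mul hZy (sub_eq_zero.mpr hx₀) hdet')).exists
  obtain ⟨hrδ, hrr₀⟩ := lt_min_iff.mp hr.2
  have hsphere : ∀ x ∈ sphere x₀ r, Z x - y ≠ 0 := fun x hx h => by
    have hxx₀ : x = x₀ := hinj (hball (sphere_subset_closedBall.trans
      (closedBall_subset_ball hrr₀) hx)) hxV ((sub_eq_zero.mp h).trans hx₀.symm)
    exact ne_of_mem_sphere hx hr.1.ne' hxx₀
  obtain ⟨m, hm, hmZ⟩ := exists_pos_le_norm_of_isCompact (isCompact_sphere x₀ r)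
    hZy.continuous.continuousOn hsphere
  refine ⟨m / 2, half_pos hm, fun W hW hWZ => ?_⟩
  have hne : ∃ᶠ ε in 𝓝[>] (0 : ℝ), degreeIntegral (fun x => Z x - y) (ball x₀ r) ε ≠ 0 := by
    refine (hdeg.and eventually_mem_nhdsWithin).frequently.mono fun ε hε => ?_
    rw [hε.1]
    exact mul_ne_zero (by rcases hdet'.lt_or_gt with h | h <;> simp [h])
      (integral_radialBump_pos hε.2).ne'
  obtain ⟨x, hx, hWx⟩ := exists_eq_zero_of_frequently_degreeIntegral_ne_zero hZy isOpen_ball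
    isBounded_ball hne (g := fun x => W x - y) (hW.sub continuous_const) fun x hx => by
      rw [frontier_ball x₀ hr.1.ne'] at hx
      rw [sub_sub_sub_cancel_right]
      exact (hWZ x).trans_lt ((half_lt_self hm).trans_le (hmZ x hx))
  exact ⟨x, sub_eq_zero.mp hWx, (mem_ball_iff_norm.mp hx).trans hrδ⟩

theorem natAbs_signedCount_le_encard (Z : EuclideanSpace ℝ (Fin n) → EuclideanSpace ℝ (Fin n))
    (U : Set (EuclideanSpace ℝ (Fin n))) (y : EuclideanSpace ℝ (Fin n)) :
    ((signedCount Z U y).natAbs : ℕ∞) ≤ {x | x ∈ U ∧ Z x = y}.encard := by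
  obtain hinf | hfin := {x | x ∈ U ∧ Z x = y}.finite_or_infinite.symm
  · simp [hinf.encard_eq]
  rw [signedCount, finsum_mem_eq_finite_toFinset_sum _ hfin, hfin.encard_eq_coe_toFinset_card,
    Nat.cast_le, Finset.card_eq_sum_ones]
  refine (Int.natAbs_sum_le _ _).trans (Finset.sum_le_sum fun x _ => ?_)
  cases SignType.sign (fderiv ℝ Z x).det <;> simp

theorem HasBrouwerDegree.natAbs_le_encard_isStableSolution {d : ℤ} (hZ : ContDiff ℝ ∞ Z)
    (hd : HasBrouwerDegree Z U y d) (hreg : ∀ x, Z x = y → (fderiv ℝ Z x).det ≠ 0) :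
    (d.natAbs : ℕ∞) ≤ {x | IsStableSolution Z y x}.encard := by
  have hself : IsRegularApprox Z U y Z := ⟨hZ, fun x _ z hz => by
    rw [sub_self, norm_zero, norm_pos_iff, sub_ne_zero]
    exact fun hzy => hd.notMem ⟨z, hz, hzy⟩, fun x _ => hreg x⟩
  rw [← hd.eq_signedCount Z hself]
  exact (natAbs_signedCount_le_encard Z U y).trans <| encard_le_encard fun x hx =>
    isStableSolution_of_det_ne_zero (hZ.of_le (by simp)) hx.2 (hreg x hx.2)

end Stability

section PolyFun

open MvPolynomial

theorem pderiv_pderiv_comm {σ R : Type*} [CommRing R] (i j : σ) (P : MvPolynomial σ R) :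
    pderiv i (pderiv j P) = pderiv j (pderiv i P) := by
  classical
  have hbracket : ⁅(pderiv i : Derivation R (MvPolynomial σ R) (MvPolynomial σ R)), pderiv j⁆ = 0 :=
    derivation_ext fun k => by
      rw [Derivation.commutator_apply]
      simp [pderiv_X, Pi.single_apply, apply_ite]
  rw [← sub_eq_zero, ← Derivation.commutator_apply, hbracket, Derivation.zero_apply]

theorem eval_smul_of_isHomogeneous {σ R : Type*} [CommSemiring R] {P : MvPolynomial σ R} {k : ℕ}
    (hP : P.IsHomogeneous k) (r : R) (x : σ → R) : eval (r • x) P = r ^ k * eval x P := by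
  simp only [eval_eq, Pi.smul_apply, smul_eq_mul, Finset.mul_sum]
  refine Finset.sum_congr rfl fun d hd => ?_
  have hdeg : ∑ i ∈ d.support, d i = k := by
    simpa [Finsupp.weight_apply, Finsupp.sum] using hP (mem_support_iff.mp hd)
  simp only [mul_pow, Finset.prod_mul_distrib, Finset.prod_pow_eq_pow_sum, hdeg]
  ring

theorem hasFDerivAt_eval {𝕜 σ : Type*} [NontriviallyNormedField 𝕜] [Fintype σ]
    (P : MvPolynomial σ 𝕜) (x : σ → 𝕜) :
    HasFDerivAt (fun x : σ → 𝕜 => eval x P)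
      (∑ i, eval x (pderiv i P) • (ContinuousLinearMap.proj i : (σ → 𝕜) →L[𝕜] 𝕜)) x := by
  classical
  induction P using MvPolynomial.induction_on with
  | C a =>
    simp only [eval_C]
    refine (hasFDerivAt_const a x).congr_fderiv ?_
    ext v
    simp
  | add p q hp hq =>
    simp only [map_add]
    refine (hp.add hq).congr_fderiv ?_
    ext v
    simp [add_mul, Finset.sum_add_distrib]
  | mul_X p j hp =>
    simp only [map_mul, eval_X]
    refine (hp.mul (hasFDerivAt_apply j x)).congr_fderiv ?_
    ext v
    simp [pderiv_X, Pi.single_apply, add_mul, Finset.sum_add_distrib, Finset.mul_sum, mul_assoc,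
      apply_ite]

variable {P : MvPolynomial (Fin 2) ℝ}

theorem hasFDerivAt_polyFun (P : MvPolynomial (Fin 2) ℝ) (x : EuclideanSpace ℝ (Fin 2)) :
    HasFDerivAt (polyFun P)
      (∑ i, polyFun (pderiv i P) x • (EuclideanSpace.proj i : EuclideanSpace ℝ (Fin 2) →L[ℝ] ℝ))
      x := by
  refine ((hasFDerivAt_eval P _).comp x
    (EuclideanSpace.equiv (Fin 2) ℝ).hasFDerivAt).congr_fderiv ?_
  ext v
  simp only [ContinuousLinearMap.comp_apply, FunLike.coe_sum, Finset.sum_apply]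
  rfl

theorem contDiff_polyFun (P : MvPolynomial (Fin 2) ℝ) : ContDiff ℝ ∞ (polyFun P) :=
  contDiffOn_univ.mp ((AnalyticOnNhd.eval_continuousLinearMap
    (EuclideanSpace.equiv (Fin 2) ℝ).toContinuousLinearMap P).contDiffOn uniqueDiffOn_univ)

theorem polyFun_smul {k : ℕ} (hP : P.IsHomogeneous k) (r : ℝ) (x : EuclideanSpace ℝ (Fin 2)) :
    polyFun P (r • x) = r ^ k * polyFun P x :=
  eval_smul_of_isHomogeneous hP r _

theorem sum_mul_polyFun_pderiv {k : ℕ} (hP : P.IsHomogeneous k) (x : EuclideanSpace ℝ (Fin 2)) :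
    ∑ i, x i * polyFun (pderiv i P) x = k * polyFun P x := by
  simpa [polyFun] using congrArg (eval fun i => x i) hP.sum_X_mul_pderiv

theorem gradMap_apply (P : MvPolynomial (Fin 2) ℝ) (x : EuclideanSpace ℝ (Fin 2)) (i : Fin 2) :
    gradMap P x i = polyFun (pderiv i P) x := by
  classical
  have h : inner ℝ (gradMap P x) (EuclideanSpace.single i 1) =
      fderiv ℝ (polyFun P) x (EuclideanSpace.single i 1) := inner_gradient_left
  simpa [(hasFDerivAt_polyFun P x).fderiv, -Fin.sum_univ_two, EuclideanSpace.inner_single_right,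
    Pi.single_apply] using h

theorem contDiff_gradMap (P : MvPolynomial (Fin 2) ℝ) : ContDiff ℝ ∞ (gradMap P) := by
  refine contDiff_euclidean.mpr fun i => ?_
  simp only [gradMap_apply]
  exact contDiff_polyFun _

theorem gradMap_smul {k : ℕ} (hP : P.IsHomogeneous k) (r : ℝ) (x : EuclideanSpace ℝ (Fin 2)) :
    gradMap P (r • x) = r ^ (k - 1) • gradMap P x := by
  ext i
  simp only [gradMap_apply, PiLp.smul_apply, smul_eq_mul, polyFun_smul hP.pderiv]

theorem fderiv_gradMap_apply (P : MvPolynomial (Fin 2) ℝ) (x v : EuclideanSpace ℝ (Fin 2))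
    (i : Fin 2) :
    fderiv ℝ (gradMap P) x v i = ∑ j, polyFun (pderiv j (pderiv i P)) x * v j := by
  have h := ((EuclideanSpace.proj i : EuclideanSpace ℝ (Fin 2) →L[ℝ] ℝ).hasFDerivAt.comp x
    ((contDiff_gradMap P).differentiable (by simp) x).hasFDerivAt).unique
    ((hasFDerivAt_polyFun (pderiv i P) x).congr_of_eventuallyEq
      (.of_forall fun z => gradMap_apply P z i))
  simpa using DFunLike.congr_fun h v

theorem det_euclideanSpace_fin_two
    (L : EuclideanSpace ℝ (Fin 2) →L[ℝ] EuclideanSpace ℝ (Fin 2)) :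
    L.det = L (EuclideanSpace.single 0 1) 0 * L (EuclideanSpace.single 1 1) 1 -
      L (EuclideanSpace.single 1 1) 0 * L (EuclideanSpace.single 0 1) 1 := by
  rw [ContinuousLinearMap.det, ← LinearMap.det_toMatrix (EuclideanSpace.basisFun _ ℝ).toBasis,
    Matrix.det_fin_two]
  simp [LinearMap.toMatrix_apply]

theorem det_fderiv_gradMap (P : MvPolynomial (Fin 2) ℝ) (x : EuclideanSpace ℝ (Fin 2)) :
    (fderiv ℝ (gradMap P) x).det =
      polyFun (pderiv 0 (pderiv 0 P)) x * polyFun (pderiv 1 (pderiv 1 P)) x -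
        polyFun (pderiv 0 (pderiv 1 P)) x ^ 2 := by
  simp [det_euclideanSpace_fin_two, fderiv_gradMap_apply, pderiv_pderiv_comm 0 1 P, sq]

end PolyFun

section NodalLines

open MvPolynomial

variable {P : MvPolynomial (Fin 2) ℝ} {k : ℕ} {u w : EuclideanSpace ℝ (Fin 2)}

theorem mem_nodalLines_iff (hP : P.IsHomogeneous k)
    {L : Submodule ℝ (EuclideanSpace ℝ (Fin 2))} :
    L ∈ nodalLines P ↔ ∃ v ≠ 0, polyFun P v = 0 ∧ L = Submodule.span ℝ {v} := by
  constructor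
  · rintro ⟨hrank, hL⟩
    obtain ⟨⟨v, hvL⟩, hv, -⟩ := finrank_eq_one_iff'.mp hrank
    have hv0 : v ≠ 0 := fun h => hv (Subtype.ext h)
    exact ⟨v, hv0, hL v hvL, (Submodule.eq_of_le_of_finrank_eq
      ((Submodule.span_singleton_le_iff_mem v L).mpr hvL)
      ((finrank_span_singleton hv0).trans hrank.symm)).symm⟩
  · rintro ⟨v, hv0, hv, rfl⟩
    refine ⟨finrank_span_singleton hv0, fun ξ hξ => ?_⟩
    obtain ⟨c, rfl⟩ := Submodule.mem_span_singleton.mp hξ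
    rw [polyFun_smul hP, hv, mul_zero]

theorem add_smul_ne_zero_of_linearIndependent (h : LinearIndependent ℝ ![u, w]) (t : ℝ) :
    w + t • u ≠ 0 := fun h0 =>
  one_ne_zero (LinearIndependent.pair_iff.mp h t 1 (by rw [one_smul, add_comm, h0])).2

theorem injective_span_singleton_add_smul (h : LinearIndependent ℝ ![u, w]) :
    Function.Injective fun t : ℝ => Submodule.span ℝ {w + t • u} := fun s t hst => by
  obtain ⟨c, hc⟩ := Submodule.mem_span_singleton.mp
    (hst.le (Submodule.mem_span_singleton_self (w + s • u)))
  have hcoord := LinearIndependent.pair_iff.mp h (c * t - s) (c - 1) (by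
    rw [← sub_eq_zero.mpr hc]
    module)
  have hc1 : c = 1 := sub_eq_zero.mp hcoord.2
  rw [hc1, one_mul] at hcoord
  exact (sub_eq_zero.mp hcoord.1).symm

theorem nodalLines_eq_image (hP : P.IsHomogeneous k) (h : LinearIndependent ℝ ![u, w])
    (hu : polyFun P u ≠ 0) :
    nodalLines P =
      (fun t : ℝ => Submodule.span ℝ {w + t • u}) '' {t | polyFun P (w + t • u) = 0} := by
  ext L
  rw [mem_nodalLines_iff hP]
  constructor
  · rintro ⟨v, hv0, hv, rfl⟩
    have hspan := h.span_eq_top_of_card_eq_finrank (by simp)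
    have hv_span : v ∈ Submodule.span ℝ {u, w} := by
      simpa [pair_comm] using hspan.ge (Submodule.mem_top (x := v))
    obtain ⟨β, α, rfl⟩ := Submodule.mem_span_pair.mp hv_span
    have hα : α ≠ 0 := by
      rintro rfl
      rw [zero_smul, add_zero, polyFun_smul hP] at hv
      have hβ := (mul_eq_zero.mp hv).resolve_right hu
      exact hv0 (by simp [eq_zero_of_pow_eq_zero hβ])
    have hscale : β • u + α • w = α • (w + (β / α) • u) := by
      rw [smul_add, smul_smul, mul_div_cancel₀ β hα, add_comm]
    rw [hscale, polyFun_smul hP] at hv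
    refine ⟨β / α, (mul_eq_zero.mp hv).resolve_left (pow_ne_zero k hα), ?_⟩
    rw [hscale, Submodule.span_singleton_smul_eq hα.isUnit]
  · rintro ⟨t, ht, rfl⟩
    exact ⟨_, add_smul_ne_zero_of_linearIndependent h t, ht, rfl⟩

theorem ncard_nodalLines_eq (hP : P.IsHomogeneous k) (h : LinearIndependent ℝ ![u, w])
    (hu : polyFun P u ≠ 0) :
    (nodalLines P).ncard = {t : ℝ | polyFun P (w + t • u) = 0}.ncard := by
  rw [nodalLines_eq_image hP h hu, ncard_image_of_injective _ (injective_span_singleton_add_smul h)]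

/-- The restriction of `P` to the affine line `t ↦ w + t • u`, as a polynomial in `t`. -/
noncomputable def lineRestriction (P : MvPolynomial (Fin 2) ℝ) (u w : EuclideanSpace ℝ (Fin 2)) :
    Polynomial ℝ :=
  aeval (fun i => Polynomial.C (w i) + Polynomial.C (u i) * Polynomial.X) P

theorem eval_lineRestriction (P : MvPolynomial (Fin 2) ℝ) (u w : EuclideanSpace ℝ (Fin 2)) (t : ℝ) :
    (lineRestriction P u w).eval t = polyFun P (w + t • u) := by
  rw [lineRestriction, polyFun, ← Polynomial.coe_aeval_eq_eval, ← coe_aeval_eq_eval]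
  refine (comp_aeval_apply _ (Polynomial.aeval t) P).trans ?_
  have hcoord (i : Fin 2) : Polynomial.aeval t (Polynomial.C (w i) + Polynomial.C (u i) *
      Polynomial.X) = (w + t • u) i := by
    simp only [map_add, map_mul, Polynomial.aeval_C, Polynomial.aeval_X, Algebra.algebraMap_self,
      RingHom.id_apply, PiLp.add_apply, PiLp.smul_apply, smul_eq_mul, mul_comm]
  simp only [hcoord]
  rfl

theorem natDegree_lineRestriction_le (P : MvPolynomial (Fin 2) ℝ)
    (u w : EuclideanSpace ℝ (Fin 2)) : (lineRestriction P u w).natDegree ≤ P.totalDegree := by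
  simpa [lineRestriction] using aeval_natDegree_le (n := 1) P le_rfl
    (fun i => Polynomial.C (w i) + Polynomial.C (u i) * Polynomial.X) fun i => by compute_degree

theorem lineRestriction_ne_zero (hP : P.IsHomogeneous k) (hu : polyFun P u ≠ 0) :
    lineRestriction P u w ≠ 0 := by
  intro hzero
  have hoff : ∀ s ∈ ({0}ᶜ : Set ℝ), polyFun P (u + s • w) = 0 := fun s hs => by
    have hscale : u + s • w = s • (w + s⁻¹ • u) := by
      rw [smul_add, smul_smul, mul_inv_cancel₀ hs, one_smul, add_comm]
    rw [hscale, polyFun_smul hP, ← eval_lineRestriction, hzero, Polynomial.eval_zero, mul_zero]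
  have hcont : Continuous fun s : ℝ => polyFun P (u + s • w) :=
    (contDiff_polyFun P).continuous.comp (by fun_prop)
  have heq := hcont.ext_on (dense_compl_singleton 0) continuous_const hoff
  exact hu (by simpa using congrFun heq 0)

theorem finite_nodalLines_and_ncard_le (hP : P.IsHomogeneous k) (hu : polyFun P u ≠ 0)
    (hu0 : u ≠ 0) : (nodalLines P).Finite ∧ (nodalLines P).ncard ≤ k := by
  obtain ⟨w, h⟩ := exists_linearIndependent_pair_of_one_lt_finrank (R := ℝ) (by simp) hu0
  have hne := lineRestriction_ne_zero (w := w) hP hu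
  have hroots : {t : ℝ | polyFun P (w + t • u) = 0} = (lineRestriction P u w).rootSet ℝ := by
    ext t
    simp [Polynomial.mem_rootSet, hne, ← eval_lineRestriction]
  refine ⟨?_, ?_⟩
  · rw [nodalLines_eq_image hP h hu, hroots]
    exact (Polynomial.rootSet_finite _ ℝ).image _
  · rw [ncard_nodalLines_eq hP h hu, hroots]
    exact (Polynomial.ncard_rootSet_le _ ℝ).trans
      ((natDegree_lineRestriction_le P u w).trans hP.totalDegree_le)

variable {N : ℕ}

theorem IsAdmissiblePoly.pos (hP : IsAdmissiblePoly N P) : 0 < N := by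
  refine Nat.pos_of_ne_zero fun hN => ?_
  obtain ⟨v, hv⟩ := exists_ne (0 : EuclideanSpace ℝ (Fin 2))
  have hscale := gradMap_smul hP.homogeneous 0 v
  rw [zero_smul, (hP.critical_iff 0).mpr rfl, hN, pow_zero, one_smul] at hscale
  exact hv ((hP.critical_iff v).mp hscale.symm)

theorem IsAdmissiblePoly.exists_polyFun_ne_zero (hP : IsAdmissiblePoly N P) :
    ∃ u ≠ 0, polyFun P u ≠ 0 := by
  by_contra! hzero
  have hconst : polyFun P = fun _ => 0 := by
    refine (contDiff_polyFun P).continuous.ext_on (dense_compl_singleton 0) continuous_const ?_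
    exact hzero
  obtain ⟨v, hv⟩ := exists_ne (0 : EuclideanSpace ℝ (Fin 2))
  exact hv ((hP.critical_iff v).mp (by rw [gradMap, hconst, gradient_fun_const]))

theorem IsAdmissiblePoly.finite_nodalLines_and_ncard_le (hP : IsAdmissiblePoly N P) :
    (nodalLines P).Finite ∧ (nodalLines P).ncard ≤ N + 1 := by
  obtain ⟨u, hu0, hu⟩ := hP.exists_polyFun_ne_zero
  exact _root_.finite_nodalLines_and_ncard_le hP.homogeneous hu hu0

end NodalLines

section Rotation

variable {A B A' B' : ℝ → ℝ} {a b c α β : ℝ}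

theorem integral_rotation_of_ne_zero (hA : ∀ x, HasDerivAt A (A' x) x)
    (hB : ∀ x, HasDerivAt B (B' x) x)
    (hint : IntervalIntegrable (fun x => (A x * B' x - A' x * B x) / (A x ^ 2 + B x ^ 2))
      volume a b)
    (hab : a < b) (hA0 : ∀ x ∈ Ioo a b, A x ≠ 0)
    (ha : Tendsto (fun x => Real.arctan (B x / A x)) (𝓝[>] a) (𝓝 α))
    (hb : Tendsto (fun x => Real.arctan (B x / A x)) (𝓝[<] b) (𝓝 β)) :
    ∫ x in a..b, (A x * B' x - A' x * B x) / (A x ^ 2 + B x ^ 2) = β - α := by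
  refine intervalIntegral.integral_eq_sub_of_hasDerivAt_of_tendsto hab (fun x hx => ?_) hint ha hb
  have hAx := hA0 x hx
  refine ((hB x).div (hA x) hAx).arctan.congr_deriv ?_
  have hpos : A x ^ 2 + B x ^ 2 ≠ 0 := by positivity
  simp only [Pi.div_apply]
  field_simp

theorem tendsto_div_nhdsWithin_of_pos_crossing (hA : HasDerivAt A (A' c) c)
    (hB : HasDerivAt B (B' c) c) (hAc : A c = 0) (hcross : 0 < A' c / B c) :
    Tendsto (fun x => A x / B x) (𝓝[>] c) (𝓝[>] 0) ∧
      Tendsto (fun x => A x / B x) (𝓝[<] c) (𝓝[<] 0) := by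
  have hBc : B c ≠ 0 := fun h => by simp [h] at hcross
  have hquot : HasDerivAt (fun x => A x / B x) (A' c / B c) c :=
    (hA.div hB hBc).congr_deriv (by rw [hAc]; field_simp; ring)
  have hlim : Tendsto (fun x => A x / B x) (𝓝 c) (𝓝 0) := by
    simpa [hAc] using hquot.continuousAt.tendsto
  have hsign := eventually_nhdsWithin_sign_eq_of_deriv_pos (hquot.deriv ▸ hcross) (by simp [hAc])
  refine ⟨tendsto_nhdsWithin_iff.mpr ⟨hlim.mono_left nhdsWithin_le_nhds, ?_⟩,
    tendsto_nhdsWithin_iff.mpr ⟨hlim.mono_left nhdsWithin_le_nhds, ?_⟩⟩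
  · filter_upwards [hsign.filter_mono nhdsWithin_le_nhds, self_mem_nhdsWithin] with x hx hcx
    rwa [sign_pos (sub_pos.mpr hcx), sign_eq_one_iff] at hx
  · filter_upwards [hsign.filter_mono nhdsWithin_le_nhds, self_mem_nhdsWithin] with x hx hxc
    rwa [sign_neg (sub_neg.mpr hxc), sign_eq_neg_one_iff] at hx

theorem tendsto_arctan_div_nhdsGT_of_pos_crossing (hA : HasDerivAt A (A' c) c)
    (hB : HasDerivAt B (B' c) c) (hAc : A c = 0) (hcross : 0 < A' c / B c) :
    Tendsto (fun x => Real.arctan (B x / A x)) (𝓝[>] c) (𝓝 (Real.pi / 2)) := by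
  have hlim := (tendsto_div_nhdsWithin_of_pos_crossing hA hB hAc hcross).1.inv_tendsto_nhdsGT_zero
  simp only [Pi.inv_def, inv_div] at hlim
  exact Real.tendsto_arctan_atTop.mono_right nhdsWithin_le_nhds |>.comp hlim

theorem tendsto_arctan_div_nhdsLT_of_pos_crossing (hA : HasDerivAt A (A' c) c)
    (hB : HasDerivAt B (B' c) c) (hAc : A c = 0) (hcross : 0 < A' c / B c) :
    Tendsto (fun x => Real.arctan (B x / A x)) (𝓝[<] c) (𝓝 (-(Real.pi / 2))) := by
  have hlim := (tendsto_div_nhdsWithin_of_pos_crossing hA hB hAc hcross).2.inv_tendsto_nhdsLT_zero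
  simp only [Pi.inv_def, inv_div] at hlim
  exact Real.tendsto_arctan_atBot.mono_right nhdsWithin_le_nhds |>.comp hlim

/-- At a zero of `A` with `0 < A' / B` the curve `(A, B)` crosses the second axis clockwise, so that
`arctan (B / A)` jumps by `π` while the angle is continuous. -/
theorem integral_rotation_eq (hA : ∀ x, HasDerivAt A (A' x) x) (hB : ∀ x, HasDerivAt B (B' x) x)
    (hrot : Continuous fun x => (A x * B' x - A' x * B x) / (A x ^ 2 + B x ^ 2))
    (hcross : ∀ x, A x = 0 → 0 < A' x / B x) (hab : a < b)
    {Z : Finset ℝ} (hZ : ∀ x, x ∈ Z ↔ x ∈ Ioo a b ∧ A x = 0)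
    (ha : Tendsto (fun x => Real.arctan (B x / A x)) (𝓝[>] a) (𝓝 α))
    (hb : Tendsto (fun x => Real.arctan (B x / A x)) (𝓝[<] b) (𝓝 β)) :
    ∫ x in a..b, (A x * B' x - A' x * B x) / (A x ^ 2 + B x ^ 2) =
      β - α - Real.pi * Z.card := by
  have hint := hrot.intervalIntegrable (μ := volume)
  induction Z using Finset.induction_on_max generalizing b β with
  | empty =>
    rw [integral_rotation_of_ne_zero hA hB (hint a b) hab
      (fun x hx h0 => Finset.notMem_empty x ((hZ x).mpr ⟨hx, h0⟩)) ha hb]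
    simp
  | insert c Z hmax ih =>
    obtain ⟨⟨hac, hcb⟩, hAc⟩ := (hZ c).mp (Finset.mem_insert_self c Z)
    have hcZ : c ∉ Z := fun h => (hmax c h).false
    have hZc : ∀ x, x ∈ Z ↔ x ∈ Ioo a c ∧ A x = 0 := fun x => by
      refine ⟨fun hx => ?_, fun ⟨hx, h0⟩ => Finset.mem_of_mem_insert_of_ne
        ((hZ x).mpr ⟨⟨hx.1, hx.2.trans hcb⟩, h0⟩) hx.2.ne⟩
      obtain ⟨hxab, h0⟩ := (hZ x).mp (Finset.mem_insert_of_mem hx)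
      exact ⟨⟨hxab.1, hmax x hx⟩, h0⟩
    have hleft := ih hac hZc
      (tendsto_arctan_div_nhdsLT_of_pos_crossing (hA c) (hB c) hAc (hcross c hAc))
    have hright := integral_rotation_of_ne_zero hA hB (hint c b) hcb
      (fun x hx h0 => by
        rcases Finset.mem_insert.mp ((hZ x).mpr ⟨⟨hac.trans hx.1, hx.2⟩, h0⟩) with rfl | hxZ
        · exact hx.1.false
        · exact (hx.1.trans (hmax x hxZ)).false)
      (tendsto_arctan_div_nhdsGT_of_pos_crossing (hA c) (hB c) hAc (hcross c hAc)) hb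
    rw [← intervalIntegral.integral_add_adjacent_intervals (hint a c) (hint c b), hleft, hright,
      Finset.card_insert_of_notMem hcZ]
    push_cast
    ring

end Rotation

section UnitCircle

open MvPolynomial

variable {P : MvPolynomial (Fin 2) ℝ} {k : ℕ}

/-- The unit vector of angle `θ`. -/
noncomputable def unitVec (θ : ℝ) : EuclideanSpace ℝ (Fin 2) := !₂[Real.cos θ, Real.sin θ]

theorem norm_unitVec (θ : ℝ) : ‖unitVec θ‖ = 1 := by
  simp [unitVec, EuclideanSpace.norm_eq]

theorem unitVec_ne_zero (θ : ℝ) : unitVec θ ≠ 0 := by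
  simp [← norm_ne_zero_iff, norm_unitVec]

theorem unitVec_add_pi (θ : ℝ) : unitVec (θ + Real.pi) = (-1 : ℝ) • unitVec θ := by
  ext i
  fin_cases i <;> simp [unitVec]

theorem exists_eq_norm_smul_unitVec (v : EuclideanSpace ℝ (Fin 2)) :
    ∃ θ, v = ‖v‖ • unitVec θ := by
  have hnorm : ‖(⟨v 0, v 1⟩ : ℂ)‖ = ‖v‖ := by
    simp [EuclideanSpace.norm_eq, Complex.norm_eq_sqrt_sq_add_sq]
  refine ⟨Complex.arg ⟨v 0, v 1⟩, ?_⟩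
  ext i
  fin_cases i <;> simp [unitVec, ← hnorm]

theorem hasDerivAt_unitVec (θ : ℝ) :
    HasDerivAt unitVec !₂[-Real.sin θ, Real.cos θ] θ := by
  refine (PiLp.continuousLinearEquiv 2 ℝ fun _ : Fin 2 => ℝ).symm.hasFDerivAt.comp_hasDerivAt θ
    (f := fun θ => ![Real.cos θ, Real.sin θ]) (hasDerivAt_pi.mpr fun i => ?_)
  fin_cases i
  · exact Real.hasDerivAt_cos θ
  · exact Real.hasDerivAt_sin θ

theorem continuous_unitVec : Continuous unitVec :=
  continuous_iff_continuousAt.mpr fun θ => (hasDerivAt_unitVec θ).continuousAt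

theorem periodic_span_unitVec :
    Function.Periodic (fun θ => Submodule.span ℝ {unitVec θ}) Real.pi := fun θ => by
  simp only [unitVec_add_pi]
  exact Submodule.span_singleton_smul_eq isUnit_one.neg _

theorem injOn_span_unitVec (a : ℝ) :
    InjOn (fun θ => Submodule.span ℝ {unitVec θ}) (Ioo a (a + Real.pi)) := by
  intro θ hθ φ hφ h
  obtain ⟨c, hc⟩ := Submodule.mem_span_singleton.mp
    (h.le (Submodule.mem_span_singleton_self (unitVec θ)))
  have hcos : c * Real.cos φ = Real.cos θ := congrArg (fun v : EuclideanSpace ℝ (Fin 2) => v 0) hc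
  have hsin : c * Real.sin φ = Real.sin θ := congrArg (fun v : EuclideanSpace ℝ (Fin 2) => v 1) hc
  have hzero : Real.sin (θ - φ) = 0 := by
    rw [Real.sin_sub, ← hcos, ← hsin]
    ring
  exact sub_eq_zero.mp ((Real.sin_eq_zero_iff_of_lt_of_lt (by linarith [hθ.1, hφ.2])
    (by linarith [hθ.2, hφ.1])).mp hzero)

theorem nodalLines_eq_image_unitVec (hP : P.IsHomogeneous k) {a : ℝ}
    (ha : polyFun P (unitVec a) ≠ 0) :
    nodalLines P = (fun θ => Submodule.span ℝ {unitVec θ}) ''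
      {θ ∈ Ioo a (a + Real.pi) | polyFun P (unitVec θ) = 0} := by
  ext L
  constructor
  · intro hL
    obtain ⟨v, hv0, -, rfl⟩ := (mem_nodalLines_iff hP).mp hL
    obtain ⟨φ, hφ⟩ := exists_eq_norm_smul_unitVec v
    obtain ⟨θ, hθ, hspan⟩ := periodic_span_unitVec.exists_mem_Ico Real.pi_pos φ a
    have hv : Submodule.span ℝ {unitVec θ} = Submodule.span ℝ {v} := by
      rw [hφ, Submodule.span_singleton_smul_eq (norm_ne_zero_iff.mpr hv0).isUnit]
      exact hspan.symm
    have hzero := hL.2 (unitVec θ) (hv ▸ Submodule.mem_span_singleton_self _)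
    have haθ : a ≠ θ := fun h => ha (h ▸ hzero)
    exact ⟨θ, ⟨⟨hθ.1.lt_of_ne haθ, hθ.2⟩, hzero⟩, hv⟩
  · rintro ⟨θ, ⟨-, hzero⟩, rfl⟩
    exact (mem_nodalLines_iff hP).mpr ⟨_, unitVec_ne_zero θ, hzero, rfl⟩

theorem ncard_nodalLines_eq_ncard_unitVec (hP : P.IsHomogeneous k) {a : ℝ}
    (ha : polyFun P (unitVec a) ≠ 0) :
    (nodalLines P).ncard = {θ ∈ Ioo a (a + Real.pi) | polyFun P (unitVec θ) = 0}.ncard := by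
  rw [nodalLines_eq_image_unitVec hP ha,
    ((injOn_span_unitVec a).mono fun θ hθ => hθ.1).ncard_image]

end UnitCircle

section AngularDerivative

open MvPolynomial

variable {P : MvPolynomial (Fin 2) ℝ} {k N : ℕ}

/-- The derivative of `P` along the rotation field `(-x₁, x₀)`; on the unit circle it is the
derivative with respect to the angle. -/
noncomputable def rotDeriv (P : MvPolynomial (Fin 2) ℝ) : MvPolynomial (Fin 2) ℝ :=
  X 0 * pderiv 1 P - X 1 * pderiv 0 P

theorem isHomogeneous_rotDeriv (hP : P.IsHomogeneous (k + 1)) :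
    (rotDeriv P).IsHomogeneous (k + 1) := by
  rw [add_comm k 1]
  exact ((isHomogeneous_X ℝ 0).mul hP.pderiv).sub ((isHomogeneous_X ℝ 1).mul hP.pderiv)

theorem polyFun_rotDeriv (P : MvPolynomial (Fin 2) ℝ) (x : EuclideanSpace ℝ (Fin 2)) :
    polyFun (rotDeriv P) x = x 0 * polyFun (pderiv 1 P) x - x 1 * polyFun (pderiv 0 P) x := by
  simp [polyFun, rotDeriv]

theorem polyFun_rotDeriv_rotDeriv (P : MvPolynomial (Fin 2) ℝ) (x : EuclideanSpace ℝ (Fin 2)) :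
    polyFun (rotDeriv (rotDeriv P)) x =
      x 0 ^ 2 * polyFun (pderiv 1 (pderiv 1 P)) x + x 1 ^ 2 * polyFun (pderiv 0 (pderiv 0 P)) x -
        2 * x 0 * x 1 * polyFun (pderiv 0 (pderiv 1 P)) x -
        (x 0 * polyFun (pderiv 0 P) x + x 1 * polyFun (pderiv 1 P) x) := by
  simp only [polyFun, rotDeriv, map_sub, Derivation.leibniz, pderiv_X_self, smul_eq_mul, map_mul,
    map_add, eval_X, map_one, pderiv_X_of_ne (one_ne_zero (α := Fin 2)),
    pderiv_X_of_ne (zero_ne_one (α := Fin 2)), map_zero, pderiv_pderiv_comm 1 0 P]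
  ring

theorem hasDerivAt_polyFun_unitVec (P : MvPolynomial (Fin 2) ℝ) (θ : ℝ) :
    HasDerivAt (fun θ => polyFun P (unitVec θ)) (polyFun (rotDeriv P) (unitVec θ)) θ := by
  refine ((hasFDerivAt_polyFun P (unitVec θ)).comp_hasDerivAt θ
    (hasDerivAt_unitVec θ)).congr_deriv ?_
  simp [polyFun_rotDeriv, unitVec]
  ring

theorem norm_sq_mul_norm_gradMap_sq (hP : P.IsHomogeneous k) (x : EuclideanSpace ℝ (Fin 2)) :
    ‖x‖ ^ 2 * ‖gradMap P x‖ ^ 2 = (k * polyFun P x) ^ 2 + polyFun (rotDeriv P) x ^ 2 := by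
  rw [← sum_mul_polyFun_pderiv hP, polyFun_rotDeriv]
  simp only [EuclideanSpace.norm_sq_eq, Real.norm_eq_abs, sq_abs, gradMap_apply, Fin.sum_univ_two]
  ring

/-- The right-hand side is the determinant of the Hessian form in the basis `x`, `(-x₁, x₀)`. -/
theorem norm_pow_four_mul_det_fderiv_gradMap (hP : P.IsHomogeneous (N + 1))
    (x : EuclideanSpace ℝ (Fin 2)) :
    ‖x‖ ^ 4 * (fderiv ℝ (gradMap P) x).det =
      (N + 1) * N * polyFun P x * (polyFun (rotDeriv (rotDeriv P)) x + (N + 1) * polyFun P x) -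
        (N * polyFun (rotDeriv P) x) ^ 2 := by
  have euler := sum_mul_polyFun_pderiv hP x
  have euler₀ := sum_mul_polyFun_pderiv (hP.pderiv (i := 0)) x
  have euler₁ := sum_mul_polyFun_pderiv (hP.pderiv (i := 1)) x
  simp only [Fin.sum_univ_two, Nat.cast_add, Nat.cast_one, Nat.add_sub_cancel,
    pderiv_pderiv_comm 1 0 P] at euler euler₀ euler₁
  have radial : (N + 1) * N * polyFun P x =
      x 0 ^ 2 * polyFun (pderiv 0 (pderiv 0 P)) x + x 1 ^ 2 * polyFun (pderiv 1 (pderiv 1 P)) x +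
        2 * x 0 * x 1 * polyFun (pderiv 0 (pderiv 1 P)) x := by
    linear_combination -N * euler - x 0 * euler₀ - x 1 * euler₁
  have mixed : N * polyFun (rotDeriv P) x =
      x 0 * x 1 * (polyFun (pderiv 1 (pderiv 1 P)) x - polyFun (pderiv 0 (pderiv 0 P)) x) +
        (x 0 ^ 2 - x 1 ^ 2) * polyFun (pderiv 0 (pderiv 1 P)) x := by
    rw [polyFun_rotDeriv]
    linear_combination x 1 * euler₀ - x 0 * euler₁
  have hnorm : ‖x‖ ^ 4 = (x 0 ^ 2 + x 1 ^ 2) ^ 2 := by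
    rw [show 4 = 2 * 2 from rfl, pow_mul, EuclideanSpace.norm_sq_eq]
    simp
  rw [radial, mixed, polyFun_rotDeriv_rotDeriv, ← euler, det_fderiv_gradMap, hnorm]
  ring

end AngularDerivative

section AngularIntegral

variable {P : MvPolynomial (Fin 2) ℝ} {k N : ℕ}

theorem det_fderiv_gradMap_smul (hP : P.IsHomogeneous k) (r : ℝ) (x : EuclideanSpace ℝ (Fin 2)) :
    (fderiv ℝ (gradMap P) (r • x)).det = (r ^ (k - 2)) ^ 2 * (fderiv ℝ (gradMap P) x).det := by
  simp only [det_fderiv_gradMap, polyFun_smul (k := k - 2) hP.pderiv.pderiv]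
  ring

/-- The derivative with respect to `θ` of the argument of `∇P (unitVec θ)`, when `P` is homogeneous
of degree `N + 1`. The usual formula for it simplifies since `D∇P x` maps `x` to `N • ∇P x`. -/
noncomputable def gradAngularSpeed (N : ℕ) (P : MvPolynomial (Fin 2) ℝ) (θ : ℝ) : ℝ :=
  (fderiv ℝ (gradMap P) (unitVec θ)).det / (N * ‖gradMap P (unitVec θ)‖ ^ 2)

theorem IsAdmissiblePoly.gradMap_ne_zero (hP : IsAdmissiblePoly N P)
    {x : EuclideanSpace ℝ (Fin 2)} (hx : x ≠ 0) : gradMap P x ≠ 0 :=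
  mt (hP.critical_iff x).mp hx

theorem IsAdmissiblePoly.continuous_gradAngularSpeed (hP : IsAdmissiblePoly N P) :
    Continuous (gradAngularSpeed N P) := by
  have hgrad := contDiff_gradMap P
  refine ((continuous_det_fderiv (hgrad.of_le (by simp))).comp continuous_unitVec).div
    (continuous_const.mul ((hgrad.continuous.comp continuous_unitVec).norm.pow 2)) fun θ => ?_
  have hN := hP.pos.ne'
  have hne := norm_ne_zero_iff.mpr (hP.gradMap_ne_zero (unitVec_ne_zero θ))
  positivity

theorem periodic_gradAngularSpeed (hP : P.IsHomogeneous (N + 1)) :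
    Function.Periodic (gradAngularSpeed N P) Real.pi := fun θ => by
  simp only [gradAngularSpeed, unitVec_add_pi, det_fderiv_gradMap_smul hP, gradMap_smul hP,
    norm_smul, norm_pow, norm_neg, norm_one, one_pow, one_mul, pow_right_comm (-1 : ℝ), neg_one_sq]

/-- In the frame `unitVec θ`, `unitVec (θ + π / 2)` the gradient has the coordinates `(N + 1) * P`
and `rotDeriv P`, and the frame itself rotates with angular speed `1`. -/
theorem IsAdmissiblePoly.gradAngularSpeed_eq (hP : IsAdmissiblePoly N P) (θ : ℝ) :
    gradAngularSpeed N P θ = 1 +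
      ((N + 1) * polyFun P (unitVec θ) * polyFun (rotDeriv (rotDeriv P)) (unitVec θ) -
        (N + 1) * polyFun (rotDeriv P) (unitVec θ) * polyFun (rotDeriv P) (unitVec θ)) /
        (((N + 1) * polyFun P (unitVec θ)) ^ 2 + polyFun (rotDeriv P) (unitVec θ) ^ 2) := by
  have hN : (N : ℝ) ≠ 0 := Nat.cast_ne_zero.mpr hP.pos.ne'
  have hnorm := norm_sq_mul_norm_gradMap_sq hP.homogeneous (unitVec θ)
  have hdet := norm_pow_four_mul_det_fderiv_gradMap hP.homogeneous (unitVec θ)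
  rw [norm_unitVec, one_pow, one_mul] at hnorm hdet
  push_cast at hnorm
  have hne : ((N + 1) * polyFun P (unitVec θ)) ^ 2 + polyFun (rotDeriv P) (unitVec θ) ^ 2 ≠ 0 :=
    hnorm ▸ pow_ne_zero 2 (norm_ne_zero_iff.mpr (hP.gradMap_ne_zero (unitVec_ne_zero θ)))
  rw [gradAngularSpeed, hnorm, hdet, one_add_div hne, div_eq_div_iff (mul_ne_zero hN hne) hne]
  ring

theorem IsAdmissiblePoly.polyFun_rotDeriv_unitVec_ne_zero (hP : IsAdmissiblePoly N P) {θ : ℝ}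
    (hθ : polyFun P (unitVec θ) = 0) : polyFun (rotDeriv P) (unitVec θ) ≠ 0 := fun h => by
  have hnorm := norm_sq_mul_norm_gradMap_sq hP.homogeneous (unitVec θ)
  simp [hθ, h, norm_unitVec, hP.gradMap_ne_zero (unitVec_ne_zero θ)] at hnorm

theorem IsAdmissiblePoly.finite_setOf_polyFun_unitVec_eq_zero (hP : IsAdmissiblePoly N P) {a : ℝ}
    (ha : polyFun P (unitVec a) ≠ 0) :
    {θ ∈ Ioo a (a + Real.pi) | polyFun P (unitVec θ) = 0}.Finite :=
  Finite.of_finite_image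
    (nodalLines_eq_image_unitVec hP.homogeneous ha ▸ hP.finite_nodalLines_and_ncard_le.1)
    ((injOn_span_unitVec a).mono fun _ hθ => hθ.1)

theorem IsAdmissiblePoly.integral_gradAngularSpeed_add_pi (hP : IsAdmissiblePoly N P) {a : ℝ}
    (ha : polyFun P (unitVec a) ≠ 0) :
    ∫ θ in a..a + Real.pi, gradAngularSpeed N P θ = Real.pi * (1 - (nodalLines P).ncard) := by
  have hN : (N + 1 : ℝ) ≠ 0 := by positivity
  set A : ℝ → ℝ := fun θ => (N + 1) * polyFun P (unitVec θ) with hA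
  set B : ℝ → ℝ := fun θ => polyFun (rotDeriv P) (unitVec θ) with hB
  have hdA : ∀ θ, HasDerivAt A ((N + 1) * B θ) θ := fun θ =>
    (hasDerivAt_polyFun_unitVec P θ).const_mul _
  have hdB := hasDerivAt_polyFun_unitVec (rotDeriv P)
  have hA0 : ∀ θ, A θ = 0 ↔ polyFun P (unitVec θ) = 0 := fun θ => by simp [hA, hN]
  have hcross : ∀ θ, A θ = 0 → 0 < (N + 1) * B θ / B θ := fun θ hθ => by
    rw [mul_div_cancel_right₀ _ (hP.polyFun_rotDeriv_unitVec_ne_zero ((hA0 θ).mp hθ))]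
    positivity
  have hrot := (hP.continuous_gradAngularSpeed.sub (continuous_const (y := 1))).congr
    fun θ => sub_eq_iff_eq_add'.mpr (hP.gradAngularSpeed_eq θ)
  have hcont : ∀ θ, A θ ≠ 0 → ContinuousAt (fun θ => Real.arctan (B θ / A θ)) θ := fun θ hθ =>
    Real.continuous_arctan.continuousAt.comp'
      ((hdB θ).continuousAt.div (hdA θ).continuousAt hθ)
  have hperiod : B (a + Real.pi) / A (a + Real.pi) = B a / A a := by
    simp only [hA, hB, unitVec_add_pi, polyFun_smul hP.homogeneous,
      polyFun_smul (isHomogeneous_rotDeriv hP.homogeneous), mul_left_comm (N + 1 : ℝ)]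
    exact mul_div_mul_left _ _ (by simp)
  have hAa : A a ≠ 0 := mt (hA0 a).mp ha
  have hAb : A (a + Real.pi) ≠ 0 := by
    rw [Ne, hA0, unitVec_add_pi, polyFun_smul hP.homogeneous]
    exact mul_ne_zero (by simp) ha
  have hfin := hP.finite_setOf_polyFun_unitVec_eq_zero ha
  have key := integral_rotation_eq hdA hdB hrot hcross (lt_add_of_pos_right a Real.pi_pos)
    (Z := hfin.toFinset) (fun θ => by simp [hA0])
    ((hcont a hAa).tendsto.mono_left nhdsWithin_le_nhds)
    ((hcont _ hAb).tendsto.mono_left nhdsWithin_le_nhds)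
  rw [hperiod, sub_self, ← ncard_eq_toFinset_card _ hfin,
    ← ncard_nodalLines_eq_ncard_unitVec hP.homogeneous ha] at key
  simp only [funext hP.gradAngularSpeed_eq]
  rw [intervalIntegral.integral_add (by simp) (hrot.intervalIntegrable _ _)]
  simp only [hA, hB] at key
  rw [key]
  simp
  ring

theorem IsAdmissiblePoly.integral_gradAngularSpeed (hP : IsAdmissiblePoly N P) :
    ∫ θ in -Real.pi..Real.pi, gradAngularSpeed N P θ =
      2 * Real.pi * (1 - (nodalLines P).ncard) := by
  obtain ⟨u, -, hu⟩ := hP.exists_polyFun_ne_zero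
  obtain ⟨a, ha⟩ := exists_eq_norm_smul_unitVec u
  rw [ha, polyFun_smul hP.homogeneous] at hu
  have hper := periodic_gradAngularSpeed hP.homogeneous
  have hint := hP.continuous_gradAngularSpeed.intervalIntegrable (μ := volume)
  have hhalf : ∀ b, ∫ θ in b..b + Real.pi, gradAngularSpeed N P θ =
      Real.pi * (1 - (nodalLines P).ncard) := fun b => by
    rw [hper.intervalIntegral_add_eq b a,
      hP.integral_gradAngularSpeed_add_pi (right_ne_zero_of_mul hu)]
  have hneg := hhalf (-Real.pi)
  have hpos := hhalf 0
  rw [neg_add_cancel] at hneg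
  rw [zero_add] at hpos
  rw [← intervalIntegral.integral_add_adjacent_intervals (hint _ 0) (hint 0 _), hneg, hpos]
  ring

end AngularIntegral

section PolarCoordinates

theorem integrableOn_polarCoord_symm {E : Type*} [NormedAddCommGroup E] [NormedSpace ℝ E]
    {f : ℝ × ℝ → E} (hf : Integrable f) :
    IntegrableOn (fun p => p.1 • f (polarCoord.symm p)) polarCoord.target := by
  have himage := (integrableOn_image_iff_integrableOn_abs_det_fderiv_smul volume
    polarCoord.open_target.measurableSet
    (fun p _ => (hasFDerivAt_polarCoord_symm p).hasFDerivWithinAt)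
    polarCoord.symm.injOn f).mp hf.integrableOn
  simp only [det_fderivPolarCoordSymm] at himage
  refine himage.congr_fun (fun p hp => ?_) polarCoord.open_target.measurableSet
  rw [polarCoord_target] at hp
  simp only [abs_of_pos (mem_Ioi.mp hp.1)]

theorem integral_euclideanSpace_fin_two_eq_polar {E : Type*} [NormedAddCommGroup E]
    [NormedSpace ℝ E] {F : EuclideanSpace ℝ (Fin 2) → E} (hF : Integrable F) :
    ∫ x, F x = ∫ θ in -Real.pi..Real.pi, ∫ r in Ioi (0 : ℝ), r • F (r • unitVec θ) := by
  set e : ℝ × ℝ ≃ᵐ EuclideanSpace ℝ (Fin 2) :=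
    MeasurableEquiv.finTwoArrow.symm.trans (MeasurableEquiv.toLp 2 (Fin 2 → ℝ))
  have he : MeasurePreserving e :=
    (EuclideanSpace.volume_preserving_symm_measurableEquiv_toLp (Fin 2)).symm.comp
      (volume_preserving_finTwoArrow ℝ).symm
  have hpolar : ∀ p, e (polarCoord.symm p) = p.1 • unitVec p.2 := fun p => by
    ext i
    fin_cases i <;> simp [e, unitVec]
  have hint := integrableOn_polarCoord_symm
    ((he.integrable_comp_emb e.measurableEmbedding).mpr hF)
  simp only [Function.comp_apply, hpolar, polarCoord_target] at hint
  rw [← he.integral_comp', ← integral_comp_polarCoord_symm, polarCoord_target]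
  simp only [hpolar]
  rw [intervalIntegral.integral_of_le (neg_le_self Real.pi_pos.le), integral_Ioc_eq_integral_Ioo]
  rw [IntegrableOn, Measure.volume_eq_prod, ← Measure.prod_restrict] at hint
  rw [Measure.volume_eq_prod, ← Measure.prod_restrict, integral_prod_symm _ hint]

theorem integral_Ioi_comp_pow_mul {N : ℕ} (hN : N ≠ 0) {ρ : ℝ} (hρ : 0 < ρ) (g : ℝ → ℝ) :
    ∫ r in Ioi (0 : ℝ), r * (g (r ^ N * ρ) * (r ^ (N - 1)) ^ 2) =
      (N * ρ ^ 2)⁻¹ * ∫ s in Ioi (0 : ℝ), s * g s := by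
  have hpow := integral_comp_rpow_Ioi_of_pos (g := fun s => s * g (s * ρ))
    (Nat.cast_pos.mpr hN.bot_lt : (0 : ℝ) < N)
  have hscale := integral_comp_mul_right_Ioi (fun s => s * g s) 0 hρ
  have hsubst : ∀ r : ℝ, r * (g (r ^ N * ρ) * (r ^ (N - 1)) ^ 2) =
      (N : ℝ)⁻¹ * ((N * r ^ ((N : ℝ) - 1)) • (r ^ (N : ℝ) * g (r ^ (N : ℝ) * ρ))) := fun r => by
    rw [← Nat.cast_pred hN.bot_lt, Real.rpow_natCast, Real.rpow_natCast, smul_eq_mul,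
      ← pow_sub_one_mul hN r]
    field_simp
  have hfactor : ∀ s, s * g (s * ρ) = ρ⁻¹ * (s * ρ * g (s * ρ)) := fun s => by field_simp
  simp only [hsubst, integral_const_mul, hpow]
  simp only [hfactor, integral_const_mul, hscale, zero_mul, smul_eq_mul]
  rw [mul_inv, ← mul_assoc, ← mul_assoc, sq, mul_inv, mul_assoc (N : ℝ)⁻¹]

end PolarCoordinates

section GradientDegree

variable {N : ℕ} {P : MvPolynomial (Fin 2) ℝ}

theorem exists_pos_mul_norm_pow_le {E F : Type*} [NormedAddCommGroup E] [NormedSpace ℝ E]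
    [ProperSpace E] [NormedAddCommGroup F] [NormedSpace ℝ F] {f : E → F} {k : ℕ} (hk : k ≠ 0)
    (hf : Continuous f) (hsmul : ∀ (r : ℝ) (x : E), f (r • x) = r ^ k • f x)
    (h0 : ∀ x ≠ 0, f x ≠ 0) : ∃ c > 0, ∀ x, c * ‖x‖ ^ k ≤ ‖f x‖ := by
  obtain ⟨c, hc, hsphere⟩ := exists_pos_le_norm_of_isCompact (isCompact_sphere (0 : E) 1)
    hf.continuousOn fun x hx => h0 x (ne_zero_of_mem_unit_sphere ⟨x, hx⟩)
  refine ⟨c, hc, fun x => ?_⟩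
  rcases eq_or_ne x 0 with rfl | hx
  · simp [hk]
  · have hunit := hsphere (‖x‖⁻¹ • x) (by simp [norm_smul, hx])
    calc c * ‖x‖ ^ k ≤ ‖f (‖x‖⁻¹ • x)‖ * ‖x‖ ^ k := by gcongr
      _ = ‖f x‖ := by
        rw [hsmul, norm_smul, norm_pow, norm_inv, norm_norm, mul_right_comm, ← mul_pow,
          inv_mul_cancel₀ (norm_ne_zero_iff.mpr hx), one_pow, one_mul]

theorem integral_radialBump_eq_polar {ε : ℝ} (hε : 0 < ε) :
    ∫ v : EuclideanSpace ℝ (Fin 2), radialBump ε v =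
      2 * Real.pi * ∫ s in Ioi (0 : ℝ), s * Real.smoothTransition (1 - s ^ 2 / ε ^ 2) := by
  rw [integral_euclideanSpace_fin_two_eq_polar
    ((continuous_radialBump ε).integrable_of_hasCompactSupport (hasCompactSupport_radialBump hε))]
  simp only [radialBump, norm_smul, norm_unitVec, mul_one, Real.norm_eq_abs, sq_abs, smul_eq_mul,
    intervalIntegral.integral_const]
  ring

theorem IsAdmissiblePoly.integral_radialBump_gradMap_smul_unitVec (hP : IsAdmissiblePoly N P)
    (ε θ : ℝ) :
    ∫ r in Ioi (0 : ℝ), r • (radialBump ε (gradMap P (r • unitVec θ)) *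
        (fderiv ℝ (gradMap P) (r • unitVec θ)).det) =
      gradAngularSpeed N P θ *
        ∫ s in Ioi (0 : ℝ), s * Real.smoothTransition (1 - s ^ 2 / ε ^ 2) := by
  have hρ := norm_pos_iff.mpr (hP.gradMap_ne_zero (unitVec_ne_zero θ))
  have hradial := integral_Ioi_comp_pow_mul hP.pos.ne' hρ
    fun s => Real.smoothTransition (1 - s ^ 2 / ε ^ 2)
  rw [gradAngularSpeed, div_mul_eq_mul_div, mul_div_assoc, div_eq_inv_mul, ← hradial,
    ← integral_const_mul]
  refine setIntegral_congr_fun measurableSet_Ioi fun r hr => ?_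
  simp only [radialBump, gradMap_smul hP.homogeneous, det_fderiv_gradMap_smul hP.homogeneous,
    norm_smul, norm_pow, Real.norm_of_nonneg (mem_Ioi.mp hr).le, smul_eq_mul, Nat.add_sub_cancel,
    show N + 1 - 2 = N - 1 from rfl]
  ring

theorem IsAdmissiblePoly.degreeIntegral_gradMap (hP : IsAdmissiblePoly N P) {R ε : ℝ}
    (hε : 0 < ε) (hR : ∀ x, R ≤ ‖x‖ → ε ≤ ‖gradMap P x‖) :
    degreeIntegral (gradMap P) (ball 0 R) ε =
      (1 - (nodalLines P).ncard) * ∫ v : EuclideanSpace ℝ (Fin 2), radialBump ε v := by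
  have hzero : ∀ x ∉ ball (0 : EuclideanSpace ℝ (Fin 2)) R,
      radialBump ε (gradMap P x) * (fderiv ℝ (gradMap P) x).det = 0 := fun x hx => by
    rw [radialBump_eq_zero hε (hR x (by simpa using hx)), zero_mul]
  have hint : Integrable fun x => radialBump ε (gradMap P x) * (fderiv ℝ (gradMap P) x).det := by
    refine Continuous.integrable_of_hasCompactSupport
      (((continuous_radialBump ε).comp (contDiff_gradMap P).continuous).mul
        (continuous_det_fderiv ((contDiff_gradMap P).of_le (by simp))))
      (HasCompactSupport.of_support_subset_isCompact (isCompact_closedBall 0 R) fun x hx => ?_)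
    exact ball_subset_closedBall (not_imp_comm.mp (hzero x) hx)
  rw [degreeIntegral, setIntegral_eq_integral_of_forall_compl_eq_zero hzero,
    integral_euclideanSpace_fin_two_eq_polar hint, integral_radialBump_eq_polar hε]
  simp only [hP.integral_radialBump_gradMap_smul_unitVec, intervalIntegral.integral_mul_const,
    hP.integral_gradAngularSpeed]
  ring

theorem IsAdmissiblePoly.hasBrouwerDegree (hP : IsAdmissiblePoly N P)
    (y : EuclideanSpace ℝ (Fin 2)) : ∃ R₀ > 0, ∀ R ≥ R₀,
      HasBrouwerDegree (gradMap P) (ball 0 R) y (1 - ((nodalLines P).ncard : ℤ)) := by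
  have hf := contDiff_gradMap P
  obtain ⟨c, hc, hgrowth⟩ := exists_pos_mul_norm_pow_le hP.pos.ne' hf.continuous
    (gradMap_smul hP.homogeneous) fun _ => hP.gradMap_ne_zero
  have htop : Tendsto (fun R : ℝ => c * R ^ N) atTop atTop :=
    (tendsto_pow_atTop hP.pos.ne').const_mul_atTop hc
  obtain ⟨R₁, hR₁⟩ := eventually_atTop.mp (htop.eventually_gt_atTop ‖y‖)
  refine ⟨max R₁ 1, by positivity, fun R hR => ?_⟩
  have hRpos : 0 < R := one_pos.trans_le ((le_max_right _ _).trans hR)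
  have hyR : ‖y‖ < c * R ^ N := hR₁ R ((le_max_left _ _).trans hR)
  have hout : ∀ x, R ≤ ‖x‖ → c * R ^ N ≤ ‖gradMap P x‖ := fun x hx =>
    le_trans (by gcongr) (hgrowth x)
  have hfr : ∀ x ∈ frontier (ball (0 : EuclideanSpace ℝ (Fin 2)) R), ‖y‖ < ‖gradMap P x‖ :=
    fun x hx => by
      rw [frontier_ball _ hRpos.ne', mem_sphere_zero_iff_norm] at hx
      exact hyR.trans_le (hout x hx.ge)
  refine .of_frequently_degreeIntegral_eq hf isOpen_ball isBounded_ball ?_ ?_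
  · rintro ⟨x, hx, rfl⟩
    exact (hfr x hx).false
  · have hf₁ : ContDiff ℝ 1 (gradMap P) := hf.of_le (by simp)
    refine Eventually.frequently ?_
    filter_upwards [Ioc_mem_nhdsGT (by positivity : 0 < c * R ^ N),
      eventually_degreeIntegral_eq_of_norm_sub_lt hf₁ (hf₁.sub (contDiff_const (c := y)))
        isOpen_ball isBounded_ball fun x hx => by simpa using hfr x hx] with ε hε hshift
    rw [hshift, hP.degreeIntegral_gradMap hε.1 fun x hx => hε.2.trans (hout x hx)]
    push_cast
    rfl

end GradientDegree

section Hessian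

open MvPolynomial

variable {P : MvPolynomial (Fin 2) ℝ} {k : ℕ}

theorem fderiv_gradMap_self (hP : P.IsHomogeneous (k + 1)) (x : EuclideanSpace ℝ (Fin 2)) :
    fderiv ℝ (gradMap P) x x = (k : ℝ) • gradMap P x := by
  ext i
  rw [fderiv_gradMap_apply, PiLp.smul_apply, smul_eq_mul, gradMap_apply]
  simpa only [mul_comm, Nat.add_sub_cancel] using sum_mul_polyFun_pderiv (hP.pderiv (i := i)) x

theorem inner_gradMap_self (hP : P.IsHomogeneous k) (x : EuclideanSpace ℝ (Fin 2)) :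
    inner ℝ (gradMap P x) x = k * polyFun P x := by
  rw [← sum_mul_polyFun_pderiv hP, PiLp.inner_apply]
  simp [gradMap_apply]

theorem inner_fderiv_gradMap_comm (P : MvPolynomial (Fin 2) ℝ)
    (x v w : EuclideanSpace ℝ (Fin 2)) :
    inner ℝ (fderiv ℝ (gradMap P) x v) w = inner ℝ v (fderiv ℝ (gradMap P) x w) := by
  simp only [PiLp.inner_apply, fderiv_gradMap_apply, Fin.sum_univ_two, RCLike.inner_apply,
    conj_trivial, pderiv_pderiv_comm 1 0 P]
  ring

theorem polyFun_eq_sum_mul_pderiv_zero (hP : P.IsHomogeneous 1) (x : EuclideanSpace ℝ (Fin 2)) :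
    polyFun P x = ∑ i, x i * polyFun (pderiv i P) 0 := by
  have hconst : ∀ i, polyFun (pderiv i P) x = polyFun (pderiv i P) 0 := fun i => by
    rw [← zero_smul ℝ x, polyFun_smul (k := 0) hP.pderiv, pow_zero, one_mul]
  simpa [hconst] using (sum_mul_polyFun_pderiv hP x).symm

theorem fderiv_gradMap_comm (hP : P.IsHomogeneous 3) (x y : EuclideanSpace ℝ (Fin 2)) :
    fderiv ℝ (gradMap P) x y = fderiv ℝ (gradMap P) y x := by
  ext i
  have hlinear : ∀ j z, polyFun (pderiv j (pderiv i P)) z =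
      ∑ l, z l * polyFun (pderiv l (pderiv j (pderiv i P))) 0 := fun j z =>
    polyFun_eq_sum_mul_pderiv_zero hP.pderiv.pderiv z
  simp only [fderiv_gradMap_apply, hlinear, Fin.sum_univ_two, pderiv_pderiv_comm 1 0 (pderiv i P)]
  ring

end Hessian

section Cubic

variable {P : MvPolynomial (Fin 2) ℝ} {u w : EuclideanSpace ℝ (Fin 2)}

theorem gradMap_add_smul_of_fderiv_eq_zero (hP : P.IsHomogeneous 3)
    (hker : fderiv ℝ (gradMap P) w u = 0) (t : ℝ) :
    gradMap P (w + t • u) = gradMap P w + t ^ 2 • gradMap P u := by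
  have hker' : fderiv ℝ (gradMap P) u w = 0 := (fderiv_gradMap_comm hP u w).trans hker
  have hself : ∀ x, fderiv ℝ (gradMap P) x x = (2 : ℝ) • gradMap P x := fun x => by
    exact_mod_cast fderiv_gradMap_self hP x
  refine smul_right_injective _ (two_ne_zero (α := ℝ)) ?_
  calc (2 : ℝ) • gradMap P (w + t • u)
      = fderiv ℝ (gradMap P) w (w + t • u) + t • fderiv ℝ (gradMap P) u (w + t • u) := by
        rw [← hself, map_add, map_smul, fderiv_gradMap_comm hP _ w, fderiv_gradMap_comm hP _ u]
    _ = (2 : ℝ) • (gradMap P w + t ^ 2 • gradMap P u) := by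
        simp only [map_add, map_smul, hker, hker', hself]
        module

theorem inner_gradMap_eq_zero_of_fderiv_eq_zero (hP : P.IsHomogeneous 3)
    (hker : fderiv ℝ (gradMap P) w u = 0) : inner ℝ (gradMap P w) u = 0 := by
  have hsym := inner_fderiv_gradMap_comm P w w u
  rw [hker, fderiv_gradMap_self hP, inner_zero_right, inner_smul_left] at hsym
  simpa using hsym

theorem polyFun_add_smul_of_fderiv_eq_zero (hP : P.IsHomogeneous 3)
    (hker : fderiv ℝ (gradMap P) w u = 0) (t : ℝ) :
    polyFun P (w + t • u) = polyFun P w + t ^ 3 * polyFun P u := by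
  have hwu := inner_gradMap_eq_zero_of_fderiv_eq_zero hP hker
  have huw := inner_gradMap_eq_zero_of_fderiv_eq_zero hP ((fderiv_gradMap_comm hP u w).trans hker)
  have heuler := inner_gradMap_self hP (w + t • u)
  rw [gradMap_add_smul_of_fderiv_eq_zero hP hker] at heuler
  simp only [inner_add_left, inner_add_right, inner_smul_left, inner_smul_right, hwu, huw,
    inner_gradMap_self hP, conj_trivial] at heuler
  push_cast at heuler
  linear_combination -heuler / 3

theorem surjective_pow_of_odd {n : ℕ} (hn : Odd n) : Function.Surjective fun t : ℝ => t ^ n :=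
  fun c => by
    rcases le_total 0 c with hc | hc
    · exact ⟨_, Real.rpow_inv_natCast_pow hc hn.pos.ne'⟩
    · refine ⟨-(-c) ^ (n⁻¹ : ℝ), ?_⟩
      simp only [hn.neg_pow, Real.rpow_inv_natCast_pow (neg_nonneg.mpr hc) hn.pos.ne', neg_neg]

theorem ncard_setOf_add_pow_mul_eq_zero {n : ℕ} (hn : Odd n) (b : ℝ) {c : ℝ} (hc : c ≠ 0) :
    {t : ℝ | b + t ^ n * c = 0}.ncard = 1 := by
  obtain ⟨s, hs⟩ := surjective_pow_of_odd hn (-b / c)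
  refine ncard_eq_one.mpr ⟨s, ext fun t => ?_⟩
  rw [mem_singleton_iff, ← hn.pow_inj, show s ^ n = -b / c from hs, eq_div_iff hc,
    eq_neg_iff_add_eq_zero, add_comm]
  rfl

theorem IsAdmissiblePoly.linearIndependent_of_fderiv_eq_zero (hP : IsAdmissiblePoly 2 P)
    (hw : w ≠ 0) (hu : u ≠ 0) (hker : fderiv ℝ (gradMap P) w u = 0) :
    LinearIndependent ℝ ![u, w] := by
  refine (LinearIndependent.pair_iff' hu).mpr fun a ha => hP.gradMap_ne_zero hw ?_
  have hself := fderiv_gradMap_self hP.homogeneous w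
  nth_rewrite 2 [← ha] at hself
  rw [map_smul, hker, smul_zero] at hself
  simpa using hself.symm

theorem IsAdmissiblePoly.polyFun_ne_zero_of_fderiv_eq_zero (hP : IsAdmissiblePoly 2 P)
    (hw : w ≠ 0) (hu : u ≠ 0) (hker : fderiv ℝ (gradMap P) w u = 0) : polyFun P u ≠ 0 := by
  have hP₃ : P.IsHomogeneous 3 := hP.homogeneous
  intro hzero
  have hspan := (hP.linearIndependent_of_fderiv_eq_zero hw hu hker).span_eq_top_of_card_eq_finrank
    (by simp)
  have hmem : gradMap P u ∈ Submodule.span ℝ {u, w} := by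
    simpa [pair_comm] using hspan.ge (Submodule.mem_top (x := gradMap P u))
  obtain ⟨α, β, hαβ⟩ := Submodule.mem_span_pair.mp hmem
  have huw := inner_gradMap_eq_zero_of_fderiv_eq_zero hP₃
    ((fderiv_gradMap_comm hP₃ u w).trans hker)
  refine hP.gradMap_ne_zero hu ((inner_self_eq_zero (𝕜 := ℝ)).mp ?_)
  nth_rewrite 2 [← hαβ]
  rw [inner_add_right, inner_smul_right, inner_smul_right, inner_gradMap_self hP₃, hzero, huw]
  simp

/-- In the basis given by `w` and a kernel vector `u` of the Hessian at `w`, the cubic `P` is a sum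
of two cubes. -/
theorem IsAdmissiblePoly.ncard_nodalLines_eq_one (hP : IsAdmissiblePoly 2 P) (hw : w ≠ 0)
    (hdet : (fderiv ℝ (gradMap P) w).det = 0) : (nodalLines P).ncard = 1 := by
  obtain ⟨u, hker, hu⟩ := (Submodule.ne_bot_iff _).mp
    (LinearMap.bot_lt_ker_of_det_eq_zero hdet).ne'
  have hker : fderiv ℝ (gradMap P) w u = 0 := hker
  have hPu := hP.polyFun_ne_zero_of_fderiv_eq_zero hw hu hker
  rw [ncard_nodalLines_eq hP.homogeneous (hP.linearIndependent_of_fderiv_eq_zero hw hu hker) hPu]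
  simp only [polyFun_add_smul_of_fderiv_eq_zero hP.homogeneous hker]
  exact ncard_setOf_add_pow_mul_eq_zero (by decide) _ hPu

end Cubic

theorem IsAdmissiblePoly.natAbs_le_encard_isStableSolution {N : ℕ} {P : MvPolynomial (Fin 2) ℝ}
    (hP : IsAdmissiblePoly N P) {y : EuclideanSpace ℝ (Fin 2)}
    (hreg : ∀ x, gradMap P x = y → (fderiv ℝ (gradMap P) x).det ≠ 0) :
    ((1 - ((nodalLines P).ncard : ℤ)).natAbs : ℕ∞) ≤
      {ξ | IsStableSolution (gradMap P) y ξ}.encard := by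
  obtain ⟨R, -, hR⟩ := hP.hasBrouwerDegree y
  exact (hR R le_rfl).natAbs_le_encard_isStableSolution (contDiff_gradMap P) hreg

theorem mainTheorem4 (N : ℕ) (P : MvPolynomial (Fin 2) ℝ) (hP : IsAdmissiblePoly N P)
    (M : ℕ) (hM : M = (nodalLines P).ncard) :
    ((nodalLines P).Finite ∧ M ≤ N + 1) ∧
    (∀ η₀ : EuclideanSpace ℝ (Fin 2), ∃ R₀ > 0, ∀ R ≥ R₀,
      HasBrouwerDegree (gradMap P) (ball 0 R) η₀ (1 - (M : ℤ))) ∧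
    (∀ᵐ η₀ ∂(volume : Measure (EuclideanSpace ℝ (Fin 2))),
      ((1 - (M : ℤ)).natAbs : ℕ∞) ≤ Set.encard {ξ | IsStableSolution (gradMap P) η₀ ξ}) ∧
    (N = 2 → ∀ η₀ : EuclideanSpace ℝ (Fin 2), η₀ ≠ 0 →
      ((1 - (M : ℤ)).natAbs : ℕ∞) ≤ Set.encard {ξ | IsStableSolution (gradMap P) η₀ ξ}) := by
  subst hM
  refine ⟨hP.finite_nodalLines_and_ncard_le, hP.hasBrouwerDegree, ?almostEvery, ?quadratic⟩
  case almostEvery =>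
    filter_upwards [ae_forall_eq_imp_det_fderiv_ne_zero
      ((contDiff_gradMap P).differentiable (by simp))] with η₀ hreg
    exact hP.natAbs_le_encard_isStableSolution hreg
  case quadratic =>
    rintro rfl η₀ hη₀
    by_cases hdegenerate : ∃ ξ ≠ 0, (fderiv ℝ (gradMap P) ξ).det = 0
    · obtain ⟨ξ, hξ, hdet⟩ := hdegenerate
      simp [hP.ncard_nodalLines_eq_one hξ hdet]
    · push Not at hdegenerate
      refine hP.natAbs_le_encard_isStableSolution fun ξ hξ => hdegenerate ξ ?_
      rintro rfl
      exact hη₀ (hξ.symm.trans ((hP.critical_iff 0).mpr rfl))
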